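/- Let $d\ge 0$ be an integer and let $P\subset\mathbb{R}^d$ be a closed convex cone which is spanning ($P-P=\mathbb{R}^d$) and pointed ($P\cap(-P)=\{0\}$). Let $H$ be an infinite-dimensional separable complex Hilbert space, and let $\alpha=\{\alpha_x\}_{x\in P}$ be an $E$-semigroup over $P$ on $B(H)$, that is, a family of normal (not necessarily unital) $*$-endomorphisms of $B(H)$ such that $\alpha_x\circ\alpha_y=\alpha_{x+y}$ for all $x,y\in P$, $\alpha_0=\mathrm{id}$, and for every $\rho$ in the predual of $B(H)$ and every $T\in B(H)$ the map $P\ni x\mapsto\rho(\alpha_x(T))\in\mathbb{C}$ is continuous. Suppose that for every $x\in P$, $\alpha_x$ maps compact operators to compact operators. Then there exist a strongly continuous family $\{V_x\}_{x\in P}$ of isometries on $H$ (i.e. $x\mapsto V_x\xi$ is continuous for every $\xi\in H$) and a strictly upper triangular real $d\times d$ matrix $A$ such that 1. $\alpha_x(T)=V_xTV_x^*$ for all $x\in P$ and $T\in B(H)$, and 2. $V_xV_y=e^{i\langle Ax,y\rangle}V_{x+y}$ for all $x,y\in P$, where $\langle\cdot,\cdot\rangle$ is the standard inner product of $\mathbb{R}^d$.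 -/

import Mathlib

open scoped Pointwise InnerProductSpace

/-- A *closed convex cone of the kind used as a parameter set*: `P` is a closed convex cone in `ℝ^d`
(nonempty, being a `ProperCone`) which is spanning, `P - P = ℝ^d`, and pointed, `P ∩ -P = {0}`. -/
structure IsSpanningPointed {d : ℕ} (P : ProperCone ℝ (EuclideanSpace ℝ (Fin d))) : Prop where
  spanning : (P : Set (EuclideanSpace ℝ (Fin d))) - (P : Set (EuclideanSpace ℝ (Fin d))) = Set.univ
  pointed : (P : Set (EuclideanSpace ℝ (Fin d))) ∩ -(P : Set (EuclideanSpace ℝ (Fin d))) = {0}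

section ESemigroups

variable {H : Type*} [NormedAddCommGroup H] [InnerProductSpace ℂ H] [CompleteSpace H]

/-- `ρ : B(H) → ℂ` belongs to the predual of `B(H)` (the trace class functionals, equivalently the
`σ`-weakly continuous linear functionals): `ρ(T) = ∑ₙ ⟨ξₙ, T ηₙ⟩` for all `T`, for some
square-summable sequences of vectors `(ξₙ)` and `(ηₙ)`. Such a map is automatically linear. -/
def IsNormalFunctional (ρ : (H →L[ℂ] H) → ℂ) : Prop :=
  ∃ ξ η : ℕ → H, (Summable fun n => ‖ξ n‖ ^ 2) ∧ (Summable fun n => ‖η n‖ ^ 2) ∧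
    ∀ T : H →L[ℂ] H, HasSum (fun n => ⟪ξ n, T (η n)⟫_ℂ) (ρ T)

/-- A `*`-endomorphism of `B(H)` (not assumed to be unital) is normal, i.e. `σ`-weakly continuous:
composing with it maps the predual of `B(H)` into itself. -/
def IsNormalEndomorphism (θ : (H →L[ℂ] H) →⋆ₙₐ[ℂ] (H →L[ℂ] H)) : Prop :=
  ∀ ρ : (H →L[ℂ] H) → ℂ, IsNormalFunctional ρ → IsNormalFunctional fun T => ρ (θ T)

/-- `α = {α_x : x ∈ P}` is an E-semigroup over `P` on `B(H)`. -/
structure IsESemigroup {d : ℕ} {P : ProperCone ℝ (EuclideanSpace ℝ (Fin d))}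
    (α : P → ((H →L[ℂ] H) →⋆ₙₐ[ℂ] (H →L[ℂ] H))) : Prop where
  normal : ∀ x : P, IsNormalEndomorphism (α x)
  map_add : ∀ (x y : P) (T : H →L[ℂ] H), α x (α y T) = α (x + y) T
  map_zero : ∀ T : H →L[ℂ] H, α 0 T = T
  continuous : ∀ ρ : (H →L[ℂ] H) → ℂ, IsNormalFunctional ρ →
    ∀ T : H →L[ℂ] H, Continuous fun x : P => ρ (α x T)

/-- `θ` leaves the algebra of compact operators invariant: `θ(𝒦(H)) ⊆ 𝒦(H)`. -/
def LeavesCompactsInvariant (θ : (H →L[ℂ] H) →⋆ₙₐ[ℂ] (H →L[ℂ] H)) : Prop :=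
  ∀ T : H →L[ℂ] H, IsCompactOperator T → IsCompactOperator (θ T)

end ESemigroups

/-- A square matrix is strictly upper triangular: all entries on and below the diagonal vanish. -/
def IsStrictlyUpperTriangular {d : ℕ} (A : Matrix (Fin d) (Fin d) ℝ) : Prop :=
  ∀ i j : Fin d, j ≤ i → A i j = 0

open InnerProductSpace Filter Topology

open scoped NNReal

/-! ### Endomorphisms of `B(H)`: multiplicity and implementing isometries. -/

section Endomorphisms

variable {H : Type*} [NormedAddCommGroup H] [InnerProductSpace ℂ H] [CompleteSpace H]

/-! An endomorphism preserving compacts sends a rank one projection to a compact, hence finite rank,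
projection; its rank is the multiplicity `n x` of `α x`. Multiplicities multiply under composition,
so divisibility along rays, `n x = n (x/2) ^ 2`, forces `n x ≤ 1`, and continuity at the origin
excludes `0`. With multiplicity one, normality makes `α x` conjugation by an isometry, unique up to
a phase (`IsESemigroup.exists_implements`). It remains to choose the phases.

Along a ray, the phase ambiguity is a 2-cocycle that is continuous near the origin, and locally it
is a coboundary, so the phases can be chosen to give a one-parameter semigroup
(`exists_continuous_semigroup`). Two such semigroups commute up to a continuous bicharacter `exp (i
c s t)` (`exists_commutation_phase`).

Choose a basis of `ℝ^d` inside `P`. Ordered products of the `d` ray semigroups implement `α` on the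
points of `P` with nonnegative coordinates, with multiplier `exp (i B)` for a bilinear form `B`.
These points are cofinal, so the family extends to `P` (`exists_extension_of_cofinal`). Only the
antisymmetric part of `B` matters up to a quadratic coboundary, and it is represented by a strictly
upper triangular matrix (`exists_isStrictlyUpperTriangular`). -/

theorem IsCompactOperator.finiteDimensional_range_of_isIdempotentElem {p : H →L[ℂ] H}
    (hp : IsCompactOperator p) (hpp : IsStarProjection p) :
    FiniteDimensional ℂ (LinearMap.range (p : H →ₗ[ℂ] H)) := by
  have hid : ∀ y ∈ LinearMap.range (p : H →ₗ[ℂ] H), p y = y := by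
    rintro _ ⟨x, rfl⟩
    exact congrArg (fun f : H →L[ℂ] H => f x) hpp.isIdempotentElem.eq
  have hcl : IsClosed ((LinearMap.range (p : H →ₗ[ℂ] H) : Submodule ℂ H) : Set H) := by
    have : ((LinearMap.range (p : H →ₗ[ℂ] H) : Submodule ℂ H) : Set H) = {y | p y = y} :=
      Set.ext fun y => ⟨hid y, fun h => ⟨y, h⟩⟩
    rw [this]
    exact isClosed_eq p.continuous continuous_id
  have hV : ∀ v ∈ LinearMap.range (p : H →ₗ[ℂ] H),
      (p : H →ₗ[ℂ] H) v ∈ LinearMap.range (p : H →ₗ[ℂ] H) := fun v _ => ⟨v, rfl⟩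
  -- The identity of the closed range is a restriction of `p`, hence compact, and Riesz's theorem
  -- applies.
  have hr := IsCompactOperator.restrict (f := (p : H →ₗ[ℂ] H)) hp hV hcl
  refine FiniteDimensional.of_isCompactOperator_id (𝕜 := ℂ) ?_
  have hid' : ⇑((p : H →ₗ[ℂ] H).restrict hV) = id := funext fun y => Subtype.ext (hid y y.2)
  rwa [hid'] at hr

/-- The restriction of `θ` to the rank one operators is a sum, over `ι`, of conjugations by
isometries with mutually orthogonal ranges. -/
def HasMultiplicity (θ : (H →L[ℂ] H) →⋆ₙₐ[ℂ] (H →L[ℂ] H)) (n : ℕ) : Prop :=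
  ∃ (ι : Type) (_ : Fintype ι) (_ : DecidableEq ι) (W : ι → H → H), Fintype.card ι = n ∧
    (∀ i j ξ η, ⟪W i ξ, W j η⟫_ℂ = if i = j then ⟪ξ, η⟫_ℂ else 0) ∧
    ∀ ξ η, θ (rankOne ℂ ξ η) = ∑ i, rankOne ℂ (W i ξ) (W i η)

theorem map_rankOne_mul (θ : (H →L[ℂ] H) →⋆ₙₐ[ℂ] (H →L[ℂ] H)) (T : H →L[ℂ] H) (ξ η : H) :
    θ T * θ (rankOne ℂ ξ η) = θ (rankOne ℂ (T ξ) η) := by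
  rw [← map_mul, ContinuousLinearMap.mul_def, comp_rankOne]

theorem adjoint_map_rankOne (θ : (H →L[ℂ] H) →⋆ₙₐ[ℂ] (H →L[ℂ] H)) (ξ η : H) :
    ContinuousLinearMap.adjoint (θ (rankOne ℂ ξ η)) = θ (rankOne ℂ η ξ) := by
  rw [← ContinuousLinearMap.star_eq_adjoint, ← map_star, ContinuousLinearMap.star_eq_adjoint,
    adjoint_rankOne]

theorem isStarProjection_map_rankOne (θ : (H →L[ℂ] H) →⋆ₙₐ[ℂ] (H →L[ℂ] H)) {e : H}
    (he : ‖e‖ = 1) : IsStarProjection (θ (rankOne ℂ e e)) where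
  isIdempotentElem := by
    rw [IsIdempotentElem, map_rankOne_mul]
    simp [he]
  isSelfAdjoint := by
    rw [IsSelfAdjoint, ContinuousLinearMap.star_eq_adjoint, adjoint_map_rankOne]

omit [CompleteSpace H] in
theorem isCompactOperator_rankOne (ξ η : H) : IsCompactOperator (rankOne ℂ ξ η) := by
  rw [rankOne_def']
  exact (isCompactOperator_of_locallyCompactSpace_dom (innerSL ℂ η)).clm_comp
    (ContinuousLinearMap.toSpanSingleton ℂ ξ)

/-- Matrix units: for an orthonormal basis `f i` of the range of `θ (e ⊗ e)`, the isometries are `ξ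
↦ θ (ξ ⊗ e) (f i)`. -/
theorem LeavesCompactsInvariant.exists_hasMultiplicity
    {θ : (H →L[ℂ] H) →⋆ₙₐ[ℂ] (H →L[ℂ] H)} (hθ : LeavesCompactsInvariant θ) {e : H}
    (he : ‖e‖ = 1) : ∃ n, HasMultiplicity θ n := by
  set p := θ (rankOne ℂ e e) with hp
  have hproj : IsStarProjection p := isStarProjection_map_rankOne θ he
  have hfin : FiniteDimensional ℂ (LinearMap.range (p : H →ₗ[ℂ] H)) :=
    (hθ _ (isCompactOperator_rankOne e e)).finiteDimensional_range_of_isIdempotentElem hproj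
  let f := stdOrthonormalBasis ℂ (LinearMap.range (p : H →ₗ[ℂ] H))
  have hpf : ∀ i, p (f i) = f i := by
    intro i
    obtain ⟨x, hx⟩ := (f i).2
    rw [← hx]
    exact congrArg (fun g : H →L[ℂ] H => g x) hproj.isIdempotentElem.eq
  have hsum : p = ∑ i, rankOne ℂ (f i : H) (f i : H) := by
    obtain ⟨_, h2⟩ := isStarProjection_iff_eq_starProjection_range.mp hproj
    exact h2.trans (f.starProjection_eq_sum_rankOne)
  refine ⟨_, Fin (Module.finrank ℂ (LinearMap.range (p : H →ₗ[ℂ] H))), inferInstance, inferInstance,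
    fun i ξ => θ (rankOne ℂ ξ e) (f i), rfl, ?_, ?_⟩
  · intro i j ξ η
    rw [← ContinuousLinearMap.adjoint_inner_right, adjoint_map_rankOne,
      ← mul_apply_eq_comp, map_rankOne_mul, rankOne_apply, map_smul, smul_apply,
      map_smul, smul_apply, ← hp, hpf, inner_smul_right, ← Submodule.coe_inner,
      orthonormal_iff_ite.mp f.orthonormal]
    split_ifs <;> simp
  · intro ξ η
    have h1 : rankOne ℂ ξ η = rankOne ℂ ξ e * rankOne ℂ e e * rankOne ℂ e η := by
      simp [ContinuousLinearMap.mul_def, rankOne_comp_rankOne, he]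
    rw [h1, map_mul, map_mul, ← hp]
    conv_lhs => rw [hsum]
    rw [Finset.mul_sum, Finset.sum_mul]
    refine Finset.sum_congr rfl fun i _ => ?_
    rw [ContinuousLinearMap.mul_def, ContinuousLinearMap.mul_def, comp_rankOne, rankOne_comp,
      adjoint_map_rankOne]

/-- The vectors `W i e` form an orthonormal basis of this range, so the multiplicity is intrinsic to
`θ`. -/
theorem HasMultiplicity.finrank_range {θ : (H →L[ℂ] H) →⋆ₙₐ[ℂ] (H →L[ℂ] H)} {n : ℕ}
    (h : HasMultiplicity θ n) {e : H} (he : ‖e‖ = 1) :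
    Module.finrank ℂ (LinearMap.range (θ (rankOne ℂ e e) : H →ₗ[ℂ] H)) = n := by
  obtain ⟨ι, _, _, W, hn, horth, hsum⟩ := h
  have hon : Orthonormal ℂ (fun i => W i e) := by
    rw [orthonormal_iff_ite]
    intro i j
    simp [horth, he]
  have hr : LinearMap.range (θ (rankOne ℂ e e) : H →ₗ[ℂ] H)
      = Submodule.span ℂ (Set.range fun i => W i e) := by
    apply le_antisymm
    · rintro _ ⟨x, rfl⟩
      simp only [hsum, ContinuousLinearMap.coe_coe, sum_apply, rankOne_apply]
      exact Submodule.sum_mem _ fun i _ =>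
        Submodule.smul_mem _ _ (Submodule.subset_span ⟨i, rfl⟩)
    · rw [Submodule.span_le]
      rintro _ ⟨i, rfl⟩
      refine ⟨W i e, ?_⟩
      simp [hsum, horth, he]
  rw [hr, finrank_span_eq_card hon.linearIndependent, hn]

theorem HasMultiplicity.unique {θ : (H →L[ℂ] H) →⋆ₙₐ[ℂ] (H →L[ℂ] H)} {m n : ℕ}
    (hm : HasMultiplicity θ m) (hn : HasMultiplicity θ n) {e : H} (he : ‖e‖ = 1) : m = n :=
  (hm.finrank_range he).symm.trans (hn.finrank_range he)

theorem HasMultiplicity.comp {θ ψ χ : (H →L[ℂ] H) →⋆ₙₐ[ℂ] (H →L[ℂ] H)} {m n : ℕ}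
    (hθ : HasMultiplicity θ m) (hψ : HasMultiplicity ψ n) (h : ∀ T, θ (ψ T) = χ T) :
    HasMultiplicity χ (m * n) := by
  obtain ⟨ι, _, _, W, hm, horth, hsum⟩ := hθ
  obtain ⟨κ, _, _, U, hn, horth', hsum'⟩ := hψ
  refine ⟨ι × κ, inferInstance, inferInstance, fun i ξ => W i.1 (U i.2 ξ), by simp [hm, hn],
    ?_, ?_⟩
  · rintro ⟨i, k⟩ ⟨j, l⟩ ξ η
    simp only [horth, horth', Prod.mk.injEq]
    split_ifs <;> simp_all
  · intro ξ η
    rw [← h, hsum', map_sum, Fintype.sum_prod_type_right]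
    exact Finset.sum_congr rfl fun k _ => hsum _ _

/-- `θ` is conjugation by the isometry `V`. -/
structure Implements (θ : (H →L[ℂ] H) →⋆ₙₐ[ℂ] (H →L[ℂ] H)) (V : H →L[ℂ] H) : Prop where
  inner_map : ∀ ξ η, ⟪V ξ, V η⟫_ℂ = ⟪ξ, η⟫_ℂ
  apply : ∀ T, θ T = V ∘L T ∘L ContinuousLinearMap.adjoint V

namespace Implements

variable {θ ψ χ : (H →L[ℂ] H) →⋆ₙₐ[ℂ] (H →L[ℂ] H)} {V W : H →L[ℂ] H}

theorem norm_map (h : Implements θ V) (ξ : H) : ‖V ξ‖ = ‖ξ‖ := by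
  rw [@norm_eq_sqrt_re_inner ℂ, @norm_eq_sqrt_re_inner ℂ, h.inner_map]

theorem isometry (h : Implements θ V) : Isometry V :=
  AddMonoidHomClass.isometry_of_norm V h.norm_map

theorem adjoint_apply (h : Implements θ V) (ξ : H) :
    ContinuousLinearMap.adjoint V (V ξ) = ξ :=
  ext_inner_right ℂ fun η => by rw [ContinuousLinearMap.adjoint_inner_left, h.inner_map]

theorem apply_apply (h : Implements θ V) (T : H →L[ℂ] H) (ξ : H) : θ T (V ξ) = V (T ξ) := by
  rw [h.apply]
  simp [h.adjoint_apply]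

theorem map_rankOne (h : Implements θ V) (ξ η : H) :
    θ (rankOne ℂ ξ η) = rankOne ℂ (V ξ) (V η) := by
  rw [h.apply, rankOne_comp, comp_rankOne]
  simp

theorem comp (hθ : Implements θ V) (hψ : Implements ψ W) (h : ∀ T, θ (ψ T) = χ T) :
    Implements χ (V * W) where
  inner_map ξ η := by simp [hθ.inner_map, hψ.inner_map]
  apply T := by
    rw [← h, hψ.apply, hθ.apply, ContinuousLinearMap.mul_def, ContinuousLinearMap.adjoint_comp]
    rfl

theorem smul (h : Implements θ V) {c : ℂ} (hc : ‖c‖ = 1) : Implements θ (c • V) where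
  inner_map ξ η := by
    simp only [smul_apply, inner_smul_left, inner_smul_right, h.inner_map]
    rw [← mul_assoc, mul_comm c, ← Complex.normSq_eq_conj_mul_self, Complex.normSq_eq_norm_sq, hc]
    simp
  apply T := by
    ext ξ
    simp only [h.apply, ContinuousLinearMap.comp_apply, map_smulₛₗ, smul_apply, smul_smul,
      RingHom.id_apply]
    rw [← Complex.normSq_eq_conj_mul_self, Complex.normSq_eq_norm_sq, hc]
    simp

/-- Two isometries implementing the same endomorphism differ by a phase. -/
theorem exists_eq_smul [Nontrivial H] (hV : Implements θ V) (hW : Implements θ W) :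
    ∃ c : ℂ, ‖c‖ = 1 ∧ V = c • W := by
  obtain ⟨e, he⟩ := exists_norm_eq H zero_le_one
  have key : V = ⟪W e, V e⟫_ℂ • W := by
    ext ξ
    have h1 := hV.apply_apply (rankOne ℂ ξ e) e
    rw [hW.map_rankOne] at h1
    simpa [he] using h1.symm
  refine ⟨_, ?_, key⟩
  have h2 := hV.norm_map e
  rw [key] at h2
  simpa [norm_smul, hW.norm_map, he] using h2

theorem eq_of_smul_eq [Nontrivial H] (hV : Implements θ V) {c d : ℂ} (h : c • V = d • V) :
    c = d := by
  obtain ⟨e, he⟩ := exists_norm_eq H zero_le_one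
  have h1 := congrArg (fun f : H →L[ℂ] H => ⟪V e, f e⟫_ℂ) h
  simp only [smul_apply, inner_smul_right, hV.inner_map] at h1
  simpa [he] using h1

end Implements

/-- Continuity of an implementing family can be tested on a single matrix coefficient. -/
theorem continuousAt_of_implements {X : Type*} [TopologicalSpace X]
    {θ : X → ((H →L[ℂ] H) →⋆ₙₐ[ℂ] (H →L[ℂ] H))} {V : X → (H →L[ℂ] H)}
    (hV : ∀ x, Implements (θ x) (V x))
    (hθ : ∀ T η ζ, Continuous fun x => ⟪η, θ x T ζ⟫_ℂ) {x₀ : X} {e f : H}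
    (hc : ContinuousAt (fun x => ⟪V x e, f⟫_ℂ) x₀) (h0 : ⟪V x₀ e, f⟫_ℂ ≠ 0) (ξ : H) :
    ContinuousAt (fun x => V x ξ) x₀ := by
  have hweak : ∀ η, ContinuousAt (fun x => ⟪η, V x ξ⟫_ℂ) x₀ := by
    intro η
    -- Since `θ x (ξ ⊗ e) f = ⟪V x e, f⟫ V x ξ`, dividing by the coefficient recovers `V x ξ`
    -- weakly.
    have h1 : ContinuousAt (fun x => ⟪η, θ x (rankOne ℂ ξ e) f⟫_ℂ / ⟪V x e, f⟫_ℂ) x₀ :=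
      (hθ _ η f).continuousAt.div hc h0
    refine h1.congr ?_
    filter_upwards [hc.eventually_ne h0] with x hx
    rw [(hV x).map_rankOne, rankOne_apply, inner_smul_right]
    field_simp
  rw [ContinuousAt, tendsto_iff_norm_sub_tendsto_zero]
  -- Weak convergence with constant norm is strong convergence.
  have hsq : Tendsto (fun x => ‖V x ξ - V x₀ ξ‖ ^ 2) (𝓝 x₀) (𝓝 0) := by
    have h2 : Tendsto (fun x => 2 * ‖ξ‖ ^ 2 - 2 * (⟪V x₀ ξ, V x ξ⟫_ℂ).re) (𝓝 x₀)
        (𝓝 (2 * ‖ξ‖ ^ 2 - 2 * (⟪V x₀ ξ, V x₀ ξ⟫_ℂ).re)) :=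
      ((Complex.continuous_re.continuousAt.tendsto.comp (hweak (V x₀ ξ))).const_mul 2).const_sub _
    have h3 : (⟪V x₀ ξ, V x₀ ξ⟫_ℂ).re = ‖ξ‖ ^ 2 := by
      rw [(hV x₀).inner_map, @norm_sq_eq_re_inner ℂ]
      rfl
    rw [h3, sub_self] at h2
    refine h2.congr fun x => ?_
    rw [@norm_sub_sq ℂ, (hV x).norm_map, (hV x₀).norm_map, ← inner_conj_symm]
    simp only [RCLike.re_eq_complex_re, Complex.conj_re]
    ring
  have := hsq.sqrt
  simpa using this

omit [CompleteSpace H] in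
theorem isNormalFunctional_inner (ξ η : H) : IsNormalFunctional fun T : H →L[ℂ] H => ⟪ξ, T η⟫_ℂ := by
  have hs : ∀ ζ : H, Summable fun n : ℕ => ‖(Pi.single 0 ζ : ℕ → H) n‖ ^ 2 := fun ζ =>
    summable_of_ne_finset_zero (s := {0}) fun n hn => by
      simp [Pi.single_eq_of_ne (Finset.notMem_singleton.mp hn)]
  refine ⟨Pi.single 0 ξ, Pi.single 0 η, hs ξ, hs η, fun T => ?_⟩
  convert hasSum_single (f := fun n => ⟪(Pi.single 0 ξ : ℕ → H) n, T ((Pi.single 0 η : ℕ → H) n)⟫_ℂ)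
    0 fun n hn => by simp [Pi.single_eq_of_ne hn]
  · simp
  · simp

omit [CompleteSpace H] in
theorem HilbertBasis.norm_sum_rankOne_apply_le {ι : Type*} (b : HilbertBasis ι ℂ H) (s : Finset ι)
    (x : H) : ‖(∑ i ∈ s, rankOne ℂ (b i) (b i)) x‖ ≤ ‖x‖ := by
  refine le_of_sq_le_sq ?_ (norm_nonneg x)
  refine le_trans (le_of_eq ?_) (b.orthonormal.sum_inner_products_le x (s := s))
  rw [@norm_sq_eq_re_inner ℂ]
  simp only [sum_apply, rankOne_apply, b.orthonormal.inner_sum]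
  rw [map_sum]
  refine Finset.sum_congr rfl fun i _ => ?_
  rw [RCLike.conj_mul, ← RCLike.ofReal_pow, RCLike.ofReal_re]

omit [CompleteSpace H] in
theorem HilbertBasis.tendsto_sum_rankOne_apply {ι : Type*} (b : HilbertBasis ι ℂ H) (x : H) :
    Tendsto (fun s : Finset ι => (∑ i ∈ s, rankOne ℂ (b i) (b i)) x) atTop (𝓝 x) := by
  have h := b.hasSum_repr x
  simp only [HasSum, SummationFilter.unconditional_filter] at h
  refine h.congr fun s => ?_
  simp [sum_apply, HilbertBasis.repr_apply_apply]

omit [CompleteSpace H] in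
-- Dominated convergence in the series defining `ρ`: by Bessel the partial sums are contractions,
-- and they tend strongly to `1`.
theorem IsNormalFunctional.tendsto_sum_rankOne {ρ : (H →L[ℂ] H) → ℂ} (h : IsNormalFunctional ρ)
    {ι : Type*} (b : HilbertBasis ι ℂ H) :
    Tendsto (fun s : Finset ι => ρ (∑ i ∈ s, rankOne ℂ (b i) (b i))) atTop (𝓝 (ρ 1)) := by
  obtain ⟨ξ, η, hξ, hη, hsum⟩ := h
  simp only [fun T => (hsum T).tsum_eq.symm]
  refine tendsto_tsum_of_dominated_convergence (bound := fun n => ‖ξ n‖ * ‖η n‖) ?_ ?_ ?_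
  · refine Summable.of_nonneg_of_le (fun n => by positivity) (fun n => ?_) (hξ.add hη)
    nlinarith [sq_nonneg (‖ξ n‖ - ‖η n‖), sq_nonneg (‖ξ n‖), sq_nonneg (‖η n‖)]
  · intro n
    exact tendsto_const_nhds.inner (b.tendsto_sum_rankOne_apply (η n))
  · refine Eventually.of_forall fun s n => (norm_inner_le_norm _ _).trans ?_
    exact mul_le_mul_of_nonneg_left (b.norm_sum_rankOne_apply_le s _) (norm_nonneg _)

/-- Multiplicity one describes `θ` on rank one operators only. Normality gives `θ 1 = V V*`, and
then `θ T = θ T V V* = V T V*`. -/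
theorem HasMultiplicity.exists_implements {θ : (H →L[ℂ] H) →⋆ₙₐ[ℂ] (H →L[ℂ] H)}
    (h : HasMultiplicity θ 1) (hn : IsNormalEndomorphism θ) {e : H} (he : ‖e‖ = 1) :
    ∃ V, Implements θ V := by
  obtain ⟨ι, _, _, W, hι, horth, hsum⟩ := h
  obtain ⟨i, hi⟩ := Fintype.card_eq_one_iff.mp hι
  -- This formula supplies the linearity of `W i`, which `HasMultiplicity` does not include.
  have hW : ∀ ξ, W i ξ = θ (rankOne ℂ ξ e) (W i e) := by
    intro ξ
    rw [hsum, sum_apply, Fintype.sum_eq_single i fun j hj => (hj (hi j)).elim, rankOne_apply,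
      horth]
    simp [he]
  have hinner : ∀ ξ η, ⟪W i ξ, W i η⟫_ℂ = ⟪ξ, η⟫_ℂ := fun ξ η => by simp [horth]
  let V : H →L[ℂ] H := LinearMap.mkContinuous
    { toFun := W i
      map_add' := fun ξ η => by rw [hW (ξ + η), hW ξ, hW η]; simp
      map_smul' := fun c ξ => by rw [hW (c • ξ), hW ξ]; simp } 1 fun ξ => by
        rw [one_mul, @norm_eq_sqrt_re_inner ℂ, @norm_eq_sqrt_re_inner ℂ]
        exact (congrArg _ (congrArg _ (hinner ξ ξ))).le
  have hrank : ∀ ξ η, θ (rankOne ℂ ξ η) = rankOne ℂ (V ξ) (V η) := by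
    intro ξ η
    rw [hsum, Fintype.sum_eq_single i fun j hj => (hj (hi j)).elim]
    rfl
  have hone : θ 1 = V ∘L ContinuousLinearMap.adjoint V := by
    obtain ⟨w, b, -⟩ := exists_hilbertBasis ℂ H
    ext1 η
    refine ext_inner_left ℂ fun ξ => ?_
    have h1 := (hn _ (isNormalFunctional_inner ξ η)).tendsto_sum_rankOne b
    have h2 := (isNormalFunctional_inner (ContinuousLinearMap.adjoint V ξ)
      (ContinuousLinearMap.adjoint V η)).tendsto_sum_rankOne b
    refine (tendsto_nhds_unique h1 (h2.congr fun s => ?_)).trans ?_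
    · simp only [map_sum, hrank, sum_apply, rankOne_apply, inner_sum, inner_smul_right,
        ContinuousLinearMap.adjoint_inner_left, ContinuousLinearMap.adjoint_inner_right]
    · simp [ContinuousLinearMap.adjoint_inner_left]
  refine ⟨V, hinner, fun T => ?_⟩
  have h1 : θ T = θ T * θ 1 := by rw [← map_mul, mul_one]
  rw [h1, hone]
  ext1 η
  simp only [mul_apply_eq_comp, ContinuousLinearMap.comp_apply]
  set ζ := ContinuousLinearMap.adjoint V η
  have h2 : V ζ = θ (rankOne ℂ ζ e) (V e) := hW ζ
  rw [h2, ← mul_apply_eq_comp, map_rankOne_mul]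
  exact (hW (T ζ)).symm

end Endomorphisms

/-! ### Local cocycles, local homomorphisms and bicharacters on the half-line. -/

section RealLemmas

/-- Averaging the cocycle identity over `r ∈ [0, a]` nearly writes `b` as a coboundary of `x ↦ ∫ b
x`. The error, due to the shifted window `[y, y + a]`, is removed by integrating the identity at
`(x, z, a)` over `z ∈ [0, y]`; hence the second integral in `φ`. -/
theorem exists_eq_add_sub_of_local_cocycle {b : ℝ → ℝ → ℝ} (hb : Continuous (Function.uncurry b))
    {a : ℝ} (ha : 0 < a)
    (hc : ∀ s t r, 0 ≤ s → 0 ≤ t → 0 ≤ r → s + t + r ≤ 3 * a →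
      b s t + b (s + t) r = b t r + b s (t + r)) :
    ∃ φ : ℝ → ℝ, Continuous φ ∧
      ∀ x y, 0 ≤ x → 0 ≤ y → x + y ≤ a → b x y = φ x + φ y - φ (x + y) := by
  have hb1 : ∀ x, Continuous (b x) := fun x => hb.comp (by fun_prop : Continuous fun z => (x, z))
  have hb2 : ∀ y, Continuous fun z => b z y := fun y =>
    hb.comp (by fun_prop : Continuous fun z => (z, y))
  refine ⟨fun x => a⁻¹ * ((∫ z in (0 : ℝ)..a, b x z) - ∫ z in (0 : ℝ)..x, b z a), ?_, ?_⟩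
  · refine continuous_const.mul (Continuous.sub ?_ ?_)
    · exact intervalIntegral.continuous_parametric_intervalIntegral_of_continuous' hb 0 a
    · exact intervalIntegral.continuous_primitive (fun _ _ => (hb2 a).intervalIntegrable _ _) 0
  · intro x y hx hy hxy
    have i1 : ∀ z p q, IntervalIntegrable (b z) MeasureTheory.volume p q :=
      fun z p q => (hb1 z).intervalIntegrable _ _
    have i2 : ∀ z p q, IntervalIntegrable (fun w => b w z) MeasureTheory.volume p q :=
      fun z p q => (hb2 z).intervalIntegrable _ _
    have hyb : Continuous fun z => b x (y + z) := (hb1 x).comp (by fun_prop)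
    have hxb : Continuous fun z => b x (z + a) := (hb1 x).comp (by fun_prop)
    have hxb' : Continuous fun z => b (x + z) a := (hb2 a).comp (by fun_prop)
    have e1 : a * b x y + ∫ z in (0 : ℝ)..a, b (x + y) z
        = (∫ z in (0 : ℝ)..a, b y z) + ∫ z in (0 : ℝ)..a, b x (y + z) := by
      have : ∫ z in (0 : ℝ)..a, (b x y + b (x + y) z) = ∫ z in (0 : ℝ)..a, (b y z + b x (y + z)) := by
        refine intervalIntegral.integral_congr fun z hz => ?_
        rw [Set.uIcc_of_le ha.le] at hz
        exact hc x y z hx hy hz.1 (by linarith [hz.2])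
      rw [intervalIntegral.integral_add (by simp) (i1 _ _ _),
        intervalIntegral.integral_add (i1 _ _ _) (hyb.intervalIntegrable _ _)] at this
      simpa using this
    have e2 : (∫ z in (0 : ℝ)..y, b x z) + ∫ z in (0 : ℝ)..y, b (x + z) a
        = (∫ z in (0 : ℝ)..y, b z a) + ∫ z in (0 : ℝ)..y, b x (z + a) := by
      rw [← intervalIntegral.integral_add (i1 _ _ _) (hxb'.intervalIntegrable _ _),
        ← intervalIntegral.integral_add (i2 _ _ _) (hxb.intervalIntegrable _ _)]
      refine intervalIntegral.integral_congr fun z hz => ?_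
      rw [Set.uIcc_of_le hy] at hz
      exact hc x z a hx hz.1 ha.le (by linarith [hz.2])
    have e3 : ∫ z in (0 : ℝ)..a, b x (y + z) = ∫ z in y..(y + a), b x z := by
      rw [intervalIntegral.integral_comp_add_left (fun z => b x z) y, add_zero]
    have e4 : ∫ z in (0 : ℝ)..y, b x (z + a) = ∫ z in a..(y + a), b x z := by
      rw [intervalIntegral.integral_comp_add_right (fun z => b x z) a, zero_add]
    have e5 : ∫ z in (0 : ℝ)..y, b (x + z) a = ∫ z in x..(x + y), b z a := by
      rw [intervalIntegral.integral_comp_add_left (fun z => b z a) x, add_zero]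
    have e6 := intervalIntegral.integral_add_adjacent_intervals (i1 x 0 y) (i1 x y (y + a))
    have e7 := intervalIntegral.integral_add_adjacent_intervals (i1 x 0 a) (i1 x a (y + a))
    have e8 := intervalIntegral.integral_add_adjacent_intervals (i2 a 0 x) (i2 a x (x + y))
    have key : a * b x y = ((∫ z in (0 : ℝ)..a, b x z) - ∫ z in (0 : ℝ)..x, b z a)
        + ((∫ z in (0 : ℝ)..a, b y z) - ∫ z in (0 : ℝ)..y, b z a)
        - ((∫ z in (0 : ℝ)..a, b (x + y) z) - ∫ z in (0 : ℝ)..(x + y), b z a) := by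
      linarith
    have : b x y = a⁻¹ * (a * b x y) := by field_simp
    rw [this, key]
    ring

/-- Set `S t = σ (t / n) ^ n` for `n` large; a common refinement shows independence of `n`. The last
clause carries properties stable under powers from `σ` to `S`. -/
theorem exists_hom_of_local_hom {M : Type*} [Monoid M] {σ : ℝ≥0 → M} {a : ℝ≥0} (ha : 0 < a)
    (h0 : σ 0 = 1) (hσ : ∀ s t, s + t ≤ a → σ (s + t) = σ s * σ t) :
    ∃ S : ℝ≥0 → M, (∀ s t, S (s + t) = S s * S t) ∧ (∀ t ≤ a, S t = σ t) ∧
      ∀ t, ∃ n : ℕ, ∃ r : ℝ≥0, t = n * r ∧ S t = σ r ^ n := by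
  have hpow : ∀ (n : ℕ) (t : ℝ≥0), n * t ≤ a → σ (n * t) = σ t ^ n := by
    intro n t
    induction n with
    | zero => simp [h0]
    | succ n ih =>
      intro h
      have e : ((n + 1 : ℕ) : ℝ≥0) * t = n * t + t := by push_cast; ring
      rw [e] at h ⊢
      rw [hσ _ _ h, ih (le_self_add.trans h), pow_succ]
  let N : ℝ≥0 → ℕ := fun t => ⌈t / a⌉₊ + 1
  have hN : ∀ t, t / N t ≤ a := by
    intro t
    rw [div_le_iff₀ (by positivity), mul_comm, ← div_le_iff₀ ha]
    exact (Nat.le_ceil _).trans (by simp [N])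
  have hN0 : ∀ t, (N t : ℝ≥0) ≠ 0 := fun t => by positivity
  have hindep : ∀ (t : ℝ≥0) (n : ℕ), n ≠ 0 → t / n ≤ a → σ (t / n) ^ n = σ (t / N t) ^ N t := by
    intro t n hn h
    have hn' : (n : ℝ≥0) ≠ 0 := by exact_mod_cast hn
    have e1 : σ (t / n) = σ (t / (n * N t)) ^ N t := by
      have e : t / n = N t * (t / (n * N t)) := by field_simp [hN0 t]
      rw [e] at h
      rw [← hpow _ _ h, ← e]
    have e2 : σ (t / N t) = σ (t / (n * N t)) ^ n := by
      have h' := hN t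
      have e : t / N t = n * (t / (n * N t)) := by field_simp [hN0 t]
      rw [e] at h'
      rw [← hpow _ _ h', ← e]
    rw [e1, e2, ← pow_mul, ← pow_mul, mul_comm (N t) n]
  refine ⟨fun t => σ (t / N t) ^ N t, ?_, ?_, fun t => ⟨N t, t / N t, ?_, rfl⟩⟩
  · intro s t
    set n := N (s + t)
    have hst := hN (s + t)
    have hn : (n : ℝ≥0) ≠ 0 := hN0 _
    have hn' : n ≠ 0 := by exact_mod_cast hn
    rw [add_div] at hst
    have h1 : σ (s / n + t / n) = σ (s / n) * σ (t / n) := hσ _ _ hst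
    have h2 : σ (s / n + t / n) = σ (t / n) * σ (s / n) := by
      rw [add_comm]
      exact hσ _ _ (by rwa [add_comm])
    -- `M` need not be commutative, but both orders of the product give `σ` of the same small sum.
    have hcomm : Commute (σ (s / n)) (σ (t / n)) := h1.symm.trans h2
    change σ ((s + t) / n) ^ n = _
    rw [add_div, h1, hcomm.mul_pow, hindep s n hn' (le_self_add.trans hst),
      hindep t n hn' (le_add_self.trans hst)]
  · intro t ht
    have := hindep t 1 one_ne_zero (by simpa using ht)
    simpa using this.symm
  · field_simp [hN0 t]

theorem Complex.arg_mul_of_re_pos {z w : ℂ} (hz : 0 < z.re) (hw : 0 < w.re) :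
    (z * w).arg = z.arg + w.arg := by
  have h1 := abs_lt.mp (Complex.abs_arg_lt_pi_div_two_iff.mpr (Or.inl hz))
  have h2 := abs_lt.mp (Complex.abs_arg_lt_pi_div_two_iff.mpr (Or.inl hw))
  refine Complex.arg_mul (fun h => ?_) (fun h => ?_) ⟨by linarith [h1.1, h2.1], by linarith [h1.2, h2.2]⟩
  · simp [h] at hz
  · simp [h] at hw

theorem NNReal.exists_pos_forall_le_of_eventually {p : ℝ≥0 × ℝ≥0 → Prop}
    (h : ∀ᶠ x in 𝓝 ((0 : ℝ≥0), (0 : ℝ≥0)), p x) :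
    ∃ δ : ℝ≥0, 0 < δ ∧ ∀ s ≤ δ, ∀ t ≤ δ, p (s, t) := by
  rw [nhds_prod_eq, Filter.Eventually, Filter.mem_prod_self_iff] at h
  obtain ⟨u, hu, hp⟩ := h
  obtain ⟨ε, hε, hεu⟩ := NNReal.nhds_zero_basis.mem_iff.mp hu
  obtain ⟨δ, hδ, hδε⟩ := exists_between hε
  exact ⟨δ, hδ, fun s hs t ht =>
    hp ⟨hεu (hs.trans_lt hδε), hεu (ht.trans_lt hδε)⟩⟩

theorem NNReal.exists_tendsto_dyadic {δ : ℝ≥0} (hδ : 0 < δ) (s : ℝ≥0) :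
    ∃ k : ℕ → ℕ, Tendsto (fun m => (k m : ℝ≥0) * (δ / 2 ^ m)) atTop (𝓝 s) := by
  refine ⟨fun m => ⌊(s / δ : ℝ) * 2 ^ m⌋₊, NNReal.tendsto_coe.mp ?_⟩
  have t1 : Tendsto (fun m : ℕ => (2 : ℝ) ^ m) atTop atTop :=
    tendsto_pow_atTop_atTop_of_one_lt one_lt_two
  have t2 := (tendsto_nat_floor_mul_div_atTop (by positivity : 0 ≤ (s / δ : ℝ))).comp t1
  have t3 := t2.mul_const (δ : ℝ)
  rw [div_mul_cancel₀ _ (by exact_mod_cast hδ.ne')] at t3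
  refine t3.congr fun m => ?_
  simp only [Function.comp]
  push_cast
  ring

/-- Near the origin `ω` has positive real part, so its argument is additive in each variable and
quarters when both variables are halved. This determines `ω` on a dyadic grid, and density
concludes. -/
theorem exists_eq_exp_of_bihom {ω : ℝ≥0 → ℝ≥0 → ℂ} (hω : Continuous (Function.uncurry ω))
    (h1 : ∀ s t, ‖ω s t‖ = 1) (hl : ∀ s s' t, ω (s + s') t = ω s t * ω s' t)
    (hr : ∀ s t t', ω s (t + t') = ω s t * ω s t') :
    ∃ c : ℝ, ∀ s t : ℝ≥0, ω s t = Complex.exp (Complex.I * ((c * s * t : ℝ) : ℂ)) := by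
  have hne : ∀ s t, ω s t ≠ 0 := fun s t h => by simpa [h] using h1 s t
  have hl0 : ∀ t, ω 0 t = 1 := fun t => by
    have := hl 0 0 t
    rw [add_zero] at this
    exact (mul_eq_left₀ (hne 0 t)).mp this.symm
  have hr0 : ∀ s, ω s 0 = 1 := fun s => by
    have := hr s 0 0
    rw [add_zero] at this
    exact (mul_eq_left₀ (hne s 0)).mp this.symm
  have hlp : ∀ (n : ℕ) s t, ω (n * s) t = ω s t ^ n := by
    intro n s t
    induction n with
    | zero => simp [hl0]
    | succ n ih => rw [Nat.cast_succ, add_mul, one_mul, hl, ih, pow_succ]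
  have hrp : ∀ (n : ℕ) s t, ω s (n * t) = ω s t ^ n := by
    intro n s t
    induction n with
    | zero => simp [hr0]
    | succ n ih => rw [Nat.cast_succ, add_mul, one_mul, hr, ih, pow_succ]
  obtain ⟨δ, hδ, hpos⟩ : ∃ δ : ℝ≥0, 0 < δ ∧ ∀ s ≤ δ, ∀ t ≤ δ, 0 < (ω s t).re := by
    have hev : ∀ᶠ p : ℝ≥0 × ℝ≥0 in 𝓝 (0, 0), 0 < (Function.uncurry ω p).re :=
      (Complex.continuous_re.comp hω).continuousAt.eventually_const_lt (by simp [hl0])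
    exact NNReal.exists_pos_forall_le_of_eventually hev
  have hhalf : ∀ m : ℕ, (ω (δ / 2 ^ m) (δ / 2 ^ m)).arg = (ω δ δ).arg / 4 ^ m := by
    have hle : ∀ m : ℕ, δ / 2 ^ m ≤ δ := fun m => div_le_self zero_le (one_le_pow₀ one_le_two)
    intro m
    induction m with
    | zero => simp
    | succ m ih =>
      have e : δ / 2 ^ m = δ / 2 ^ (m + 1) + δ / 2 ^ (m + 1) := by
        rw [pow_succ]; field_simp; norm_num
      have p1 := hpos _ (hle (m + 1)) _ (hle (m + 1))
      have p2 := hpos _ (hle (m + 1)) _ (hle m)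
      have e1 : (ω (δ / 2 ^ m) (δ / 2 ^ m)).arg = 4 * (ω (δ / 2 ^ (m + 1)) (δ / 2 ^ (m + 1))).arg := by
        have a1 : (ω (δ / 2 ^ m) (δ / 2 ^ m)).arg = 2 * (ω (δ / 2 ^ (m + 1)) (δ / 2 ^ m)).arg := by
          conv_lhs => rw [e, hl, ← e, Complex.arg_mul_of_re_pos p2 p2]
          ring
        have a2 : (ω (δ / 2 ^ (m + 1)) (δ / 2 ^ m)).arg
            = 2 * (ω (δ / 2 ^ (m + 1)) (δ / 2 ^ (m + 1))).arg := by
          rw [e, hr, Complex.arg_mul_of_re_pos p1 p1]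
          ring
        rw [a1, a2]
        ring
      rw [pow_succ 4, ← div_div, ← ih, e1]
      ring
  set c₀ := (ω δ δ).arg
  have hδ' : (δ : ℝ) ≠ 0 := by exact_mod_cast hδ.ne'
  refine ⟨c₀ / (δ * δ), fun s t => ?_⟩
  obtain ⟨j, hj⟩ := NNReal.exists_tendsto_dyadic hδ s
  obtain ⟨k, hk⟩ := NNReal.exists_tendsto_dyadic hδ t
  have hjk := hj.prodMk_nhds hk
  let g : ℝ≥0 × ℝ≥0 → ℂ := fun p =>
    Complex.exp (Complex.I * ((c₀ / (δ * δ) * p.1 * p.2 : ℝ) : ℂ))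
  have hg : Continuous g := by fun_prop
  have heq : ∀ m, g (j m * (δ / 2 ^ m), k m * (δ / 2 ^ m))
      = Function.uncurry ω (j m * (δ / 2 ^ m), k m * (δ / 2 ^ m)) := by
    intro m
    simp only [g, Function.uncurry]
    rw [hlp, hrp]
    have e1 : ω (δ / 2 ^ m) (δ / 2 ^ m) = Complex.exp (((c₀ / 4 ^ m : ℝ) : ℂ) * Complex.I) := by
      rw [← hhalf m]
      conv_lhs => rw [← Complex.norm_mul_exp_arg_mul_I (ω (δ / 2 ^ m) (δ / 2 ^ m)), h1]
      simp
    rw [e1, ← Complex.exp_nat_mul, ← Complex.exp_nat_mul]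
    congr 1
    have e4 : (4 : ℂ) ^ m = 2 ^ m * 2 ^ m := by rw [← mul_pow]; norm_num
    push_cast
    rw [e4]
    have : (δ : ℂ) ≠ 0 := by exact_mod_cast hδ'
    field_simp
  exact tendsto_nhds_unique ((hω.tendsto (s, t)).comp hjk)
    (((hg.tendsto (s, t)).comp hjk).congr heq)

end RealLemmas

/-! ### One-parameter semigroups of implementing isometries. -/

section OneParameter

variable {H : Type*} [NormedAddCommGroup H] [InnerProductSpace ℂ H] [CompleteSpace H]

theorem Implements.exists_normalized {θ : (H →L[ℂ] H) →⋆ₙₐ[ℂ] (H →L[ℂ] H)} {V : H →L[ℂ] H}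
    (h : Implements θ V) (e : H) :
    ∃ W, Implements θ W ∧ ⟪W e, e⟫_ℂ = ‖⟪W e, e⟫_ℂ‖ := by
  obtain ⟨c, hc, hz⟩ := Complex.exists_norm_eq_mul_self ⟪V e, e⟫_ℂ
  refine ⟨starRingEnd ℂ c • V, h.smul (by simpa using hc), ?_⟩
  rw [smul_apply, inner_smul_left, Complex.conj_conj, ← hz]
  simp

/-- With nonnegative coefficients, `⟪V x e, e⟫` is the square root of `|⟪e, θ x (e ⊗ e) e⟫|`, which
does not depend on the phase of `V x`. -/
theorem continuous_inner_of_normalized {X : Type*} [TopologicalSpace X]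
    {θ : X → ((H →L[ℂ] H) →⋆ₙₐ[ℂ] (H →L[ℂ] H))} {V : X → (H →L[ℂ] H)}
    (hV : ∀ x, Implements (θ x) (V x))
    (hθ : ∀ T η ζ, Continuous fun x => ⟪η, θ x T ζ⟫_ℂ) {e : H}
    (he : ∀ x, ⟪V x e, e⟫_ℂ = ‖⟪V x e, e⟫_ℂ‖) : Continuous fun x => ⟪V x e, e⟫_ℂ := by
  have h1 : ∀ x, ⟪V x e, e⟫_ℂ = (Real.sqrt ‖⟪e, θ x (rankOne ℂ e e) e⟫_ℂ‖ : ℂ) := by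
    intro x
    rw [he x, (hV x).map_rankOne, rankOne_apply, inner_smul_right, norm_mul, norm_inner_symm e,
      Real.sqrt_mul_self (norm_nonneg _)]
  simp only [h1]
  exact Complex.continuous_ofReal.comp (hθ _ e e).norm.sqrt

omit [CompleteSpace H] in
theorem ContinuousAt.isometry_apply {X : Type*} [TopologicalSpace X] {V : X → (H →L[ℂ] H)} {g : X → H}
    {x₀ : X} (hV : ∀ x ξ, ‖V x ξ‖ = ‖ξ‖) (hc : ContinuousAt (fun x => V x (g x₀)) x₀)
    (hg : ContinuousAt g x₀) : ContinuousAt (fun x => V x (g x)) x₀ := by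
  rw [ContinuousAt, tendsto_iff_norm_sub_tendsto_zero] at *
  refine squeeze_zero (fun _ => norm_nonneg _) (fun x => ?_) (by simpa using hg.add hc)
  calc ‖V x (g x) - V x₀ (g x₀)‖ = ‖V x (g x - g x₀) + (V x (g x₀) - V x₀ (g x₀))‖ := by
        rw [map_sub]; congr 1; abel
    _ ≤ ‖g x - g x₀‖ + ‖V x (g x₀) - V x₀ (g x₀)‖ := by
        rw [← hV x (g x - g x₀)]; exact norm_add_le _ _

omit [CompleteSpace H] in
/-- A semigroup of isometries which is strongly continuous at the origin is strongly continuous. -/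
theorem continuous_apply_of_continuousAt_zero {S : ℝ≥0 → (H →L[ℂ] H)}
    (hS : ∀ t ξ, ‖S t ξ‖ = ‖ξ‖) (hadd : ∀ s t, S (s + t) = S s * S t) (h0 : S 0 = 1) (ξ : H)
    (hc : ContinuousAt (fun t => S t ξ) 0) : Continuous fun t => S t ξ := by
  -- Factoring out the isometry `S s` reduces every increment, to the left as well as to the right,
  -- to one at the origin.
  have hle : ∀ s r, ‖S (s + r) ξ - S s ξ‖ = ‖S r ξ - ξ‖ := by
    intro s r
    rw [hadd, mul_apply_eq_comp, ← map_sub, hS]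
  have hnn : ∀ s r : ℝ≥0, nndist (s + r) s = r := by
    intro s r
    rw [← NNReal.coe_inj, coe_nndist, NNReal.dist_eq]
    simp
  have hdist : ∀ s t, ‖S t ξ - S s ξ‖ = ‖S (nndist t s) ξ - ξ‖ := by
    intro s t
    rcases le_total s t with h | h
    · obtain ⟨r, rfl⟩ := exists_add_of_le h
      rw [hle, hnn]
    · obtain ⟨r, rfl⟩ := exists_add_of_le h
      rw [norm_sub_rev, hle, nndist_comm, hnn]
  rw [continuous_iff_continuousAt]
  intro s
  rw [ContinuousAt, tendsto_iff_norm_sub_tendsto_zero] at hc ⊢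
  simp only [hdist]
  have h1 : Tendsto (fun t => nndist t s) (𝓝 s) (𝓝 0) := by
    have : Continuous fun t => nndist t s := by fun_prop
    simpa using this.tendsto s
  simpa [h0, Function.comp_def] using hc.comp h1

/-- The normalized implementers `W` are continuous near `0`, and their multiplier `u` is close to
`1` there. Its argument is then a real cocycle; trivializing it locally corrects `W` to a local
semigroup, which extends by powers. -/
theorem exists_continuous_semigroup [Nontrivial H] {θ : ℝ≥0 → ((H →L[ℂ] H) →⋆ₙₐ[ℂ] (H →L[ℂ] H))}
    (hadd : ∀ s t T, θ s (θ t T) = θ (s + t) T) (h0 : ∀ T, θ 0 T = T)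
    (hθ : ∀ T η ζ, Continuous fun x => ⟪η, θ x T ζ⟫_ℂ) (himp : ∀ t, ∃ V, Implements (θ t) V) :
    ∃ S : ℝ≥0 → (H →L[ℂ] H), (∀ t, Implements (θ t) (S t)) ∧ (∀ s t, S (s + t) = S s * S t) ∧
      ∀ ξ, Continuous fun t => S t ξ := by
  obtain ⟨e, he⟩ := exists_norm_eq H zero_le_one
  have hn : ∀ t, ∃ W, Implements (θ t) W ∧ ⟪W e, e⟫_ℂ = ‖⟪W e, e⟫_ℂ‖ := fun t =>
    (himp t).choose_spec.exists_normalized e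
  choose W hW hWe using hn
  have hWc := continuous_inner_of_normalized hW hθ hWe
  have himp1 : Implements (θ 0) (1 : H →L[ℂ] H) := ⟨fun ξ η => rfl, fun T => by
    rw [h0, ← ContinuousLinearMap.star_eq_adjoint, star_one]; rfl⟩
  have hW0 : W 0 = 1 := by
    obtain ⟨c, hc, h⟩ := (hW 0).exists_eq_smul himp1
    have h2 := hWe 0
    have h3 : ⟪W 0 e, e⟫_ℂ = starRingEnd ℂ c := by
      rw [h, smul_apply, inner_smul_left]
      simp [he]
    rw [h3, RCLike.norm_conj, hc] at h2
    rw [h, ← Complex.conj_conj c, h2]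
    simp
  let G : Set ℝ≥0 := {t | ⟪W t e, e⟫_ℂ ≠ 0}
  have hG : IsOpen G := isOpen_ne_fun hWc continuous_const
  have hG0 : (0 : ℝ≥0) ∈ G := by simp [G, hW0, he]
  have hWs : ∀ t ∈ G, ∀ ξ, ContinuousAt (fun t => W t ξ) t := fun t ht ξ =>
    continuousAt_of_implements hW hθ hWc.continuousAt ht ξ
  let u : ℝ≥0 → ℝ≥0 → ℂ := fun s t => ⟪W (s + t) e, W s (W t e)⟫_ℂ
  have hu : ∀ s t, ‖u s t‖ = 1 ∧ W s * W t = u s t • W (s + t) := by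
    intro s t
    obtain ⟨c, hc, h⟩ := ((hW s).comp (hW t) (hadd s t)).exists_eq_smul (hW (s + t))
    have : u s t = c := by
      have h2 : W s (W t e) = c • W (s + t) e := congrArg (fun f : H →L[ℂ] H => f e) h
      simp only [u]
      rw [h2, inner_smul_right, (hW _).inner_map]
      simp [he]
    rw [this]
    exact ⟨hc, h⟩
  have huc : ∀ s t, s ∈ G → t ∈ G → s + t ∈ G → ContinuousAt (Function.uncurry u) (s, t) := by
    intro s t hs ht hst
    refine ContinuousAt.inner ?_ ?_
    · exact ContinuousAt.comp (f := fun p : ℝ≥0 × ℝ≥0 => p.1 + p.2) (x := (s, t))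
        (hWs _ hst e) (by fun_prop)
    · refine ContinuousAt.isometry_apply (V := fun p : ℝ≥0 × ℝ≥0 => W p.1)
        (g := fun p : ℝ≥0 × ℝ≥0 => W p.2 e) (fun p ξ => (hW _).norm_map ξ) ?_ ?_
      · exact ContinuousAt.comp (f := fun p : ℝ≥0 × ℝ≥0 => p.1) (x := (s, t))
          (hWs _ hs _) (by fun_prop)
      · exact ContinuousAt.comp (f := fun p : ℝ≥0 × ℝ≥0 => p.2) (x := (s, t))
          (hWs _ ht _) (by fun_prop)
  have hucoc : ∀ s t r, u s t * u (s + t) r = u t r * u s (t + r) := by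
    intro s t r
    have h1 : W s * W t * W r = (u s t * u (s + t) r) • W (s + t + r) := by
      rw [(hu s t).2, smul_mul_assoc, (hu _ _).2, smul_smul]
    have h2 : W s * (W t * W r) = (u t r * u s (t + r)) • W (s + (t + r)) := by
      rw [(hu t r).2, mul_smul_comm, (hu _ _).2, smul_smul]
    refine (hW (s + t + r)).eq_of_smul_eq ?_
    rw [← h1, mul_assoc, h2, add_assoc]
  obtain ⟨δ, hδ, hδG⟩ : ∃ δ : ℝ≥0, 0 < δ ∧ ∀ s ≤ δ, ∀ t ≤ δ,
      (s ∈ G ∧ t ∈ G ∧ s + t ∈ G) ∧ 0 < (u s t).re := by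
    refine NNReal.exists_pos_forall_le_of_eventually
      (p := fun x => (x.1 ∈ G ∧ x.2 ∈ G ∧ x.1 + x.2 ∈ G) ∧ 0 < (Function.uncurry u x).re) ?_
    have c1 : ContinuousAt (fun p : ℝ≥0 × ℝ≥0 => p.1) (0, 0) := by fun_prop
    have c2 : ContinuousAt (fun p : ℝ≥0 × ℝ≥0 => p.2) (0, 0) := by fun_prop
    have c3 : ContinuousAt (fun p : ℝ≥0 × ℝ≥0 => p.1 + p.2) (0, 0) := by fun_prop
    refine Eventually.and (Eventually.and ?_ (Eventually.and ?_ ?_)) ?_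
    · exact c1.eventually_mem (hG.mem_nhds hG0)
    · exact c2.eventually_mem (hG.mem_nhds hG0)
    · exact c3.eventually_mem (hG.mem_nhds (by simpa using hG0))
    · have c4 : ContinuousAt (fun x => (Function.uncurry u x).re) (0, 0) :=
        Complex.continuous_re.continuousAt.comp (huc 0 0 hG0 hG0 (by simpa using hG0))
      exact c4.eventually_const_lt (by simp [u, hW0, he])
  -- Truncating at `δ` makes `b` continuous on the whole plane while agreeing with the argument of
  -- `u` on `[0, δ]²`.
  let κ : ℝ → ℝ≥0 := fun s => min s.toNNReal δ
  have hκc : Continuous κ := continuous_real_toNNReal.min continuous_const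
  have hκ : ∀ s : ℝ≥0, s ≤ δ → κ s = s := fun s hs => by simpa [κ] using hs
  have hκδ : ∀ s, κ s ≤ δ := fun s => min_le_right _ _
  let b : ℝ → ℝ → ℝ := fun s t => (u (κ s) (κ t)).arg
  have hb : Continuous (Function.uncurry b) := by
    rw [continuous_iff_continuousAt]
    rintro ⟨s, t⟩
    obtain ⟨⟨h1, h2, h3⟩, h4⟩ := hδG (κ s) (hκδ s) (κ t) (hκδ t)
    refine ContinuousAt.comp (g := Complex.arg) (f := fun p : ℝ × ℝ => u (κ p.1) (κ p.2))
      (Complex.continuousAt_arg (Or.inl h4)) ?_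
    exact ContinuousAt.comp (g := Function.uncurry u) (f := fun p : ℝ × ℝ => (κ p.1, κ p.2))
      (x := (s, t)) (huc _ _ h1 h2 h3) (by fun_prop)
  -- With `a = δ / 3`, all sums in the cocycle identity stay at most `δ`, where arguments add.
  obtain ⟨φ, hφ, hφb⟩ := exists_eq_add_sub_of_local_cocycle hb
    (a := ((δ / 3 : ℝ≥0) : ℝ)) (by positivity) (by
      intro s t r hs ht hr h
      lift s to ℝ≥0 using hs
      lift t to ℝ≥0 using ht
      lift r to ℝ≥0 using hr
      have h : s + t + r ≤ δ := by
        rw [← NNReal.coe_le_coe]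
        push_cast at h ⊢
        linarith
      have hst : s + t ≤ δ := le_self_add.trans h
      have htr : t + r ≤ δ := (by rw [add_assoc] at h; exact le_add_self.trans h)
      have hs := le_self_add.trans hst
      have ht := le_self_add.trans htr
      have hr := le_add_self.trans htr
      simp only [b]
      rw [← NNReal.coe_add, ← NNReal.coe_add, hκ _ hs, hκ _ ht, hκ _ hr, hκ _ hst, hκ _ htr,
        ← Complex.arg_mul_of_re_pos (hδG _ hs _ ht).2 (hδG _ hst _ hr).2,
        ← Complex.arg_mul_of_re_pos (hδG _ ht _ hr).2 (hδG _ hs _ htr).2, hucoc])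
  have hφ0 : φ 0 = 0 := by
    have h1 := hφb 0 0 le_rfl le_rfl (by rw [add_zero]; exact NNReal.coe_nonneg _)
    have h2 : b 0 0 = 0 := by
      have : κ 0 = 0 := by simp [κ]
      simp [b, this, u, hW0, he]
    rw [h2, add_zero] at h1
    linarith
  let σ : ℝ≥0 → (H →L[ℂ] H) := fun t => Complex.exp ((-φ t : ℝ) * Complex.I) • W t
  have hσimp : ∀ t, Implements (θ t) (σ t) := fun t =>
    (hW t).smul (Complex.norm_exp_ofReal_mul_I _)
  have hσ0 : σ 0 = 1 := by simp [σ, hφ0, hW0]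
  have hσ : ∀ s t, s + t ≤ δ / 3 → σ (s + t) = σ s * σ t := by
    intro s t h
    have hδ3 : δ / 3 ≤ δ := div_le_self zero_le (by norm_num)
    have hs : s ≤ δ := (le_self_add.trans h).trans hδ3
    have ht : t ≤ δ := (le_add_self.trans h).trans hδ3
    have hbst := hφb s t s.2 t.2 (by exact_mod_cast h)
    have hu1 : u s t = Complex.exp (b s t * Complex.I) := by
      simp only [b]
      rw [hκ _ hs, hκ _ ht]
      conv_lhs => rw [← Complex.norm_mul_exp_arg_mul_I (u s t), (hu s t).1]
      simp
    simp only [σ]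
    rw [smul_mul_smul_comm, (hu s t).2, smul_smul, hu1, ← Complex.exp_add, ← Complex.exp_add, hbst]
    congr 2
    push_cast
    ring
  obtain ⟨S, hS1, hS2, hS3⟩ := exists_hom_of_local_hom (a := δ / 3) (by positivity) hσ0 hσ
  have himpow : ∀ (n : ℕ) (r : ℝ≥0), Implements (θ (n * r)) (σ r ^ n) := by
    intro n r
    induction n with
    | zero => simpa using himp1
    | succ n ih =>
      rw [pow_succ]
      refine ih.comp (hσimp r) fun T => ?_
      rw [hadd]
      congr 2
      push_cast
      ring
  have hSimp : ∀ t, Implements (θ t) (S t) := by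
    intro t
    obtain ⟨n, r, h1, h2⟩ := hS3 t
    rw [h1, ← h1, h2, h1]
    exact himpow n r
  refine ⟨S, hSimp, hS1, fun ξ => ?_⟩
  refine continuous_apply_of_continuousAt_zero (fun t => (hSimp t).norm_map) hS1
    ((hS2 0 zero_le).trans hσ0) ξ ?_
  have hσc : ContinuousAt (fun t => σ t ξ) 0 := by
    refine ContinuousAt.smul (f := fun t : ℝ≥0 => Complex.exp ((-φ t : ℝ) * Complex.I)) ?_
      (hWs 0 hG0 ξ)
    have : Continuous fun t : ℝ≥0 => Complex.exp ((-φ t : ℝ) * Complex.I) := by fun_prop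
    exact this.continuousAt
  refine hσc.congr ?_
  filter_upwards [eventually_le_nhds (show (0 : ℝ≥0) < δ / 3 by positivity)] with t ht
  rw [hS2 t ht]

end OneParameter

/-! ### Unimodular phases. -/

section Phase

/-- The phase `exp (i r)`. -/
noncomputable def phase (r : ℝ) : ℂ := Complex.exp (Complex.I * (r : ℂ))

theorem phase_add (r s : ℝ) : phase (r + s) = phase r * phase s := by
  rw [phase, phase, phase, ← Complex.exp_add]
  push_cast
  ring_nf

theorem phase_zero : phase 0 = 1 := by simp [phase]

theorem norm_phase (r : ℝ) : ‖phase r‖ = 1 := by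
  rw [phase, mul_comm, Complex.norm_exp_ofReal_mul_I]

theorem phase_ne_zero (r : ℝ) : phase r ≠ 0 := Complex.exp_ne_zero _

@[fun_prop]
theorem continuous_phase : Continuous phase := by
  unfold phase
  fun_prop

end Phase

/-! ### Ordered products under Weyl-type commutation relations. -/

section OrderedProducts

/-- The ordered product `f 0 * f 1 * ⋯ * f (n - 1)`. -/
def orderedProd {M : Type*} [Monoid M] (f : ℕ → M) : ℕ → M
  | 0 => 1
  | n + 1 => orderedProd f n * f n

variable {A : Type*} [Ring A] [Algebra ℂ A] {S : ℕ → ℝ≥0 → A} {c : ℕ → ℕ → ℝ}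

theorem mul_orderedProd (hc : ∀ j i s t, S j s * S i t = phase (c j i * s * t) • (S i t * S j s))
    (a : ℕ → ℝ≥0) (j : ℕ) (s : ℝ≥0) (n : ℕ) :
    S j s * orderedProd (fun i => S i (a i)) n =
      phase (∑ i ∈ Finset.range n, c j i * s * a i) •
        (orderedProd (fun i => S i (a i)) n * S j s) := by
  induction n with
  | zero => simp [orderedProd, phase_zero]
  | succ n ih =>
    rw [orderedProd, ← mul_assoc, ih, smul_mul_assoc, mul_assoc _ (S j s), hc, mul_smul_comm,
      smul_smul, Finset.sum_range_succ, phase_add, mul_assoc _ (S n (a n)) (S j s)]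

/-- Merging the two products moves each `S j (a j)` past the `S i (a' i)` with `i < j`, and each
exchange costs one phase. -/
theorem orderedProd_mul_orderedProd (hadd : ∀ i s t, S i (s + t) = S i s * S i t)
    (hc : ∀ j i s t, S j s * S i t = phase (c j i * s * t) • (S i t * S j s))
    (a a' : ℕ → ℝ≥0) (n : ℕ) :
    orderedProd (fun i => S i (a i)) n * orderedProd (fun i => S i (a' i)) n =
      phase (∑ j ∈ Finset.range n, ∑ i ∈ Finset.range j, c j i * a j * a' i) •
        orderedProd (fun i => S i (a i + a' i)) n := by
  induction n with
  | zero => simp [orderedProd, phase_zero]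
  | succ n ih =>
    simp only [orderedProd]
    rw [mul_assoc, ← mul_assoc (S n (a n)), mul_orderedProd hc, smul_mul_assoc, mul_smul_comm,
      mul_assoc (orderedProd (fun i => S i (a' i)) n), ← hadd, ← mul_assoc, ih, smul_mul_assoc,
      smul_smul, Finset.sum_range_succ, phase_add, mul_comm (phase _)]

end OrderedProducts

/-! ### Commutation of two ray semigroups. -/

section Operators

variable {H : Type*} [NormedAddCommGroup H] [InnerProductSpace ℂ H] [CompleteSpace H]

omit [CompleteSpace H] in
theorem norm_orderedProd_apply {f : ℕ → (H →L[ℂ] H)} (hf : ∀ i ξ, ‖f i ξ‖ = ‖ξ‖) (n : ℕ) (ξ : H) :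
    ‖orderedProd f n ξ‖ = ‖ξ‖ := by
  induction n generalizing ξ with
  | zero => simp [orderedProd]
  | succ n ih => rw [orderedProd, mul_apply_eq_comp, ih, hf]

omit [CompleteSpace H] in
theorem continuous_orderedProd_apply {X : Type*} [TopologicalSpace X] {f : X → ℕ → (H →L[ℂ] H)}
    (hf : ∀ x i ξ, ‖f x i ξ‖ = ‖ξ‖) (hc : ∀ i ξ, Continuous fun x => f x i ξ) (n : ℕ) (ξ : H) :
    Continuous fun x => orderedProd (f x) n ξ := by
  induction n generalizing ξ with
  | zero => simpa [orderedProd] using continuous_const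
  | succ n ih =>
    simp only [orderedProd, mul_apply_eq_comp]
    exact continuous_iff_continuousAt.mpr fun x =>
      ContinuousAt.isometry_apply (fun y => norm_orderedProd_apply (hf y) n)
        (ih _).continuousAt (hc n ξ).continuousAt

/-- Both products implement the same endomorphism, so they differ by a phase; the semigroup laws
make it a bicharacter, continuous by joint strong continuity. -/
theorem exists_commutation_phase [Nontrivial H]
    {θ θ' : ℝ≥0 → ((H →L[ℂ] H) →⋆ₙₐ[ℂ] (H →L[ℂ] H))}
    (hcomm : ∀ s t T, θ s (θ' t T) = θ' t (θ s T)) {S S' : ℝ≥0 → (H →L[ℂ] H)}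
    (hS : ∀ t, Implements (θ t) (S t)) (hS' : ∀ t, Implements (θ' t) (S' t))
    (hadd : ∀ s t, S (s + t) = S s * S t) (hadd' : ∀ s t, S' (s + t) = S' s * S' t)
    (hc : ∀ ξ, Continuous fun t => S t ξ) (hc' : ∀ ξ, Continuous fun t => S' t ξ) :
    ∃ c : ℝ, ∀ s t, S s * S' t = phase (c * s * t) • (S' t * S s) := by
  obtain ⟨e, he⟩ := exists_norm_eq H zero_le_one
  have hχ : ∀ s t, ∃ χ : (H →L[ℂ] H) →⋆ₙₐ[ℂ] (H →L[ℂ] H),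
      Implements χ (S s * S' t) ∧ Implements χ (S' t * S s) := fun s t =>
    ⟨(θ s).comp (θ' t), (hS s).comp (hS' t) fun T => rfl, (hS' t).comp (hS s) fun T =>
      (hcomm s t T).symm⟩
  have hinner : ∀ s t ξ η, ⟪S' t (S s ξ), S' t (S s η)⟫_ℂ = ⟪ξ, η⟫_ℂ := fun s t ξ η => by
    rw [(hS' t).inner_map, (hS s).inner_map]
  let ω : ℝ≥0 → ℝ≥0 → ℂ := fun s t => ⟪S' t (S s e), S s (S' t e)⟫_ℂ
  have hω : ∀ s t, ‖ω s t‖ = 1 ∧ S s * S' t = ω s t • (S' t * S s) := by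
    intro s t
    obtain ⟨χ, h1, h2⟩ := hχ s t
    obtain ⟨k, hk, h⟩ := h1.exists_eq_smul h2
    have h3 : S s (S' t e) = k • S' t (S s e) := congrArg (fun f : H →L[ℂ] H => f e) h
    have : ω s t = k := by
      simp only [ω]
      rw [h3, inner_smul_right, hinner]
      simp [he]
    rw [this]
    exact ⟨hk, h⟩
  have huniq : ∀ s t k, S s * S' t = k • (S' t * S s) → ω s t = k := by
    intro s t k h
    obtain ⟨χ, -, h2⟩ := hχ s t
    exact h2.eq_of_smul_eq ((hω s t).2.symm.trans h)
  have hcont : Continuous (Function.uncurry ω) := by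
    rw [continuous_iff_continuousAt]
    rintro ⟨s, t⟩
    refine ContinuousAt.inner ?_ ?_
    · refine ContinuousAt.isometry_apply (V := fun p : ℝ≥0 × ℝ≥0 => S' p.2)
        (g := fun p : ℝ≥0 × ℝ≥0 => S p.1 e) (fun p => (hS' _).norm_map) ?_ ?_
      · exact ((hc' _).comp continuous_snd).continuousAt
      · exact ((hc _).comp continuous_fst).continuousAt
    · refine ContinuousAt.isometry_apply (V := fun p : ℝ≥0 × ℝ≥0 => S p.1)
        (g := fun p : ℝ≥0 × ℝ≥0 => S' p.2 e) (fun p => (hS _).norm_map) ?_ ?_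
      · exact ((hc _).comp continuous_fst).continuousAt
      · exact ((hc' _).comp continuous_snd).continuousAt
  have hl : ∀ s s' t, ω (s + s') t = ω s t * ω s' t := fun s s' t => by
    refine huniq _ _ _ ?_
    rw [hadd, mul_assoc, (hω s' t).2, mul_smul_comm, ← mul_assoc, (hω s t).2, smul_mul_assoc,
      smul_smul, mul_assoc, mul_comm (ω s t)]
  have hr : ∀ s t t', ω s (t + t') = ω s t * ω s t' := fun s t t' => by
    refine huniq _ _ _ ?_
    rw [hadd', ← mul_assoc, (hω s t).2, smul_mul_assoc, mul_assoc, (hω s t').2, mul_smul_comm,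
      smul_smul, mul_assoc]
  obtain ⟨c, h⟩ := exists_eq_exp_of_bihom hcont (fun s t => (hω s t).1) hl hr
  exact ⟨c, fun s t => (hω s t).2.trans (by rw [h]; rfl)⟩

end Operators

/-! ### Extension from a cofinal subsemigroup. -/

section Extension

variable {H : Type*} [NormedAddCommGroup H] [InnerProductSpace ℂ H] [CompleteSpace H]

/-- A projective family of isometries given on a cofinal subsemigroup `Q` of `P`, with multiplier
`phase ∘ B` for a biadditive form `B`, extends to `P`. -/
theorem exists_extension_of_cofinal [Nontrivial H] {P : Type*} [AddCommMonoid P] [TopologicalSpace P]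
    [ContinuousAdd P] {α : P → ((H →L[ℂ] H) →⋆ₙₐ[ℂ] (H →L[ℂ] H))}
    (hadd : ∀ x y T, α x (α y T) = α (x + y) T)
    (hα : ∀ T η ζ, Continuous fun x => ⟪η, α x T ζ⟫_ℂ) (himp : ∀ x, ∃ V, Implements (α x) V)
    {B : P → P → ℝ} (hBl : ∀ x y z, B (x + y) z = B x z + B y z)
    (hBr : ∀ x y z, B x (y + z) = B x y + B x z) (hBc : ∀ y, Continuous fun x => B x y)
    {Q : Set P} (hQ : ∀ x ∈ Q, ∀ y ∈ Q, x + y ∈ Q)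
    (hcof : ∀ x₀, ∃ y ∈ Q, ∀ᶠ x in 𝓝 x₀, x + y ∈ Q) {T : P → (H →L[ℂ] H)}
    (hTimp : ∀ x ∈ Q, Implements (α x) (T x))
    (hT : ∀ x ∈ Q, ∀ y ∈ Q, T x * T y = phase (B x y) • T (x + y))
    (hTc : ∀ ξ, Continuous fun x => T x ξ) :
    ∃ V : P → (H →L[ℂ] H), (∀ x, Implements (α x) (V x)) ∧
      (∀ x y, V x * V y = phase (B x y) • V (x + y)) ∧ ∀ ξ, Continuous fun x => V x ξ := by
  have hcof' : ∀ x, ∃ y ∈ Q, x + y ∈ Q := fun x =>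
    let ⟨y, hy, h⟩ := hcof x
    ⟨y, hy, h.self_of_nhds⟩
  -- The phase of `V` is fixed by imposing the desired relation with a single `T y`.
  have hex : ∀ x, ∃ V, Implements (α x) V ∧ ∃ y ∈ Q, x + y ∈ Q ∧
      V * T y = phase (B x y) • T (x + y) := by
    intro x
    obtain ⟨y, hy, hxy⟩ := hcof' x
    obtain ⟨U, hU⟩ := himp x
    obtain ⟨c, hc, h⟩ := (hU.comp (hTimp y hy) (hadd x y)).exists_eq_smul (hTimp _ hxy)
    have hc0 : c ≠ 0 := fun h => by simp [h] at hc
    refine ⟨(phase (B x y) / c) • U, hU.smul (by rw [norm_div, norm_phase, hc, div_one]), y, hy,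
      hxy, ?_⟩
    rw [smul_mul_assoc, h, smul_smul, div_mul_cancel₀ _ hc0]
  choose V hV hVex using hex
  have hVT : ∀ x, ∀ y ∈ Q, x + y ∈ Q → V x * T y = phase (B x y) • T (x + y) := by
    intro x y hy hxy
    obtain ⟨z, hz, hxz, h⟩ := hVex x
    obtain ⟨c, hc, hcV⟩ := ((hV x).comp (hTimp y hy) (hadd x y)).exists_eq_smul (hTimp _ hxy)
    -- Computing `V x T z T y` and `V x T y T z`, then comparing them through the commutation
    -- relation of `T y` and `T z`, determines `c`.
    have e1 : V x * T z * T y = (phase (B x z) * phase (B (x + z) y)) • T (x + z + y) := by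
      rw [h, smul_mul_assoc, hT _ hxz _ hy, smul_smul]
    have e2 : V x * T y * T z = (c * phase (B (x + y) z)) • T (x + y + z) := by
      rw [hcV, smul_mul_assoc, hT _ hxy _ hz, smul_smul]
    have e3 : phase (B y z) • (T z * T y) = phase (B z y) • (T y * T z) := by
      rw [hT _ hz _ hy, hT _ hy _ hz, smul_smul, smul_smul, add_comm z y, mul_comm]
    have e4 : phase (B y z) • (V x * T z * T y) = phase (B z y) • (V x * T y * T z) := by
      rw [mul_assoc, mul_assoc, ← mul_smul_comm, e3, mul_smul_comm]
    rw [e1, e2, add_right_comm x z y, smul_smul, smul_smul] at e4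
    have e5 := (hTimp _ (hQ _ hxy _ hz)).eq_of_smul_eq e4
    rw [hBl, hBl, phase_add, phase_add] at e5
    have e6 : c = phase (B x y) := by
      have n1 := phase_ne_zero (B y z)
      have n2 := phase_ne_zero (B z y)
      have n3 := phase_ne_zero (B x z)
      have n4 : phase (B y z) * phase (B z y) * phase (B x z) ≠ 0 := by
        simp [n1, n2, n3]
      refine mul_left_cancel₀ n4 ?_
      linear_combination -e5
    rw [hcV, e6]
  refine ⟨V, hV, fun x x' => ?_, fun ξ => ?_⟩
  · obtain ⟨y, hy, hxy⟩ := hcof' x'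
    obtain ⟨z, hz, hxz⟩ := hcof' (x + x')
    have hw : y + z ∈ Q := hQ _ hy _ hz
    have h1 : x' + (y + z) ∈ Q := by
      rw [← add_assoc]
      exact hQ _ hxy _ hz
    have h2 : x + x' + (y + z) ∈ Q := by
      rw [add_comm y z, ← add_assoc]
      exact hQ _ hxz _ hy
    have h2' : x + (x' + (y + z)) ∈ Q := by rwa [← add_assoc]
    obtain ⟨c, hc, h⟩ := ((hV x).comp (hV x') (hadd x x')).exists_eq_smul (hV (x + x'))
    have e1 : V x * V x' * T (y + z)
        = (phase (B x' (y + z)) * phase (B x (x' + (y + z)))) • T (x + x' + (y + z)) := by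
      rw [mul_assoc, hVT _ _ hw h1, mul_smul_comm, hVT _ _ h1 h2', smul_smul, add_assoc]
    rw [h, smul_mul_assoc, hVT _ _ hw h2, smul_smul] at e1
    have e2 := (hTimp _ h2).eq_of_smul_eq e1
    rw [hBl, hBr x x', phase_add, phase_add] at e2
    have e3 : c = phase (B x x') := by
      refine mul_right_cancel₀ (mul_ne_zero (phase_ne_zero (B x (y + z)))
        (phase_ne_zero (B x' (y + z)))) ?_
      linear_combination e2
    rw [h, e3]
  · rw [continuous_iff_continuousAt]
    intro x₀
    obtain ⟨y, hy, hev⟩ := hcof x₀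
    obtain ⟨e, he⟩ := exists_norm_eq H zero_le_one
    have hx₀ := hVT x₀ y hy hev.self_of_nhds
    -- Near `x₀` the vector `V x (T y e)` is a continuous phase times `T (x + y) e`, and its
    -- coefficient against `V x₀ (T y e)` is `1` at `x₀`.
    refine continuousAt_of_implements hV hα (e := T y e) (f := V x₀ (T y e)) ?_ ?_ ξ
    · have h1 : Continuous fun x => ⟪phase (B x y) • T (x + y) e, V x₀ (T y e)⟫_ℂ := by
        have := (hTc e).comp (continuous_add_const y)
        have h3 := hBc y
        exact ((continuous_phase.comp h3).smul this).inner continuous_const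
      refine h1.continuousAt.congr ?_
      filter_upwards [hev] with x hx
      have := congrArg (fun f : H →L[ℂ] H => f e) (hVT x y hy hx)
      simp only [mul_apply_eq_comp, smul_apply] at this
      rw [this]
    · rw [(hV _).inner_map, (hTimp y hy).inner_map]
      simp [he]

end Extension

/-! ### Normal form of bilinear multipliers. -/

section BilinearForms

variable {d : ℕ}

/-- Up to the coboundary of a quadratic form, a bilinear form on `ℝ^d` is given by a strictly upper
triangular matrix. -/
theorem exists_isStrictlyUpperTriangular
    (B : EuclideanSpace ℝ (Fin d) →ₗ[ℝ] EuclideanSpace ℝ (Fin d) →ₗ[ℝ] ℝ) :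
    ∃ (A : Matrix (Fin d) (Fin d) ℝ) (q : EuclideanSpace ℝ (Fin d) → ℝ),
      IsStrictlyUpperTriangular A ∧ Continuous q ∧
      ∀ x y, ⟪A.toEuclideanLin x, y⟫_ℝ = B x y + q x + q y - q (x + y) := by
  let e := (EuclideanSpace.basisFun (Fin d) ℝ).toBasis
  let A : Matrix (Fin d) (Fin d) ℝ :=
    Matrix.of fun i j => if i < j then B (e j) (e i) - B (e i) (e j) else 0
  let C : EuclideanSpace ℝ (Fin d) →ₗ[ℝ] EuclideanSpace ℝ (Fin d) →ₗ[ℝ] ℝ :=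
    (innerₗ (EuclideanSpace ℝ (Fin d))) ∘ₗ A.toEuclideanLin
  have hC : ∀ x y, C x y = ⟪A.toEuclideanLin x, y⟫_ℝ := fun x y => rfl
  have hCe : ∀ i j, C (e j) (e i) = A i j := by
    intro i j
    rw [hC]
    simp [e, EuclideanSpace.inner_single_right]
  -- `A` is chosen so that `C` has the antisymmetrization of `B`; thus `B - C` is symmetric and is
  -- the polarization of the quadratic form `q` below.
  have hBC : B - B.flip = C - C.flip := by
    refine LinearMap.ext_basis e e fun j i => ?_
    simp only [LinearMap.sub_apply, LinearMap.flip_apply, hCe]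
    simp only [A, Matrix.of_apply]
    rcases lt_trichotomy i j with h | rfl | h
    · simp [h, h.not_gt]
    · simp
    · simp [h, h.not_gt]
  have hBC' : ∀ x y, B x y - B y x = C x y - C y x := fun x y =>
    congrArg (fun f => f x y) hBC
  have hcont : ∀ D : EuclideanSpace ℝ (Fin d) →ₗ[ℝ] EuclideanSpace ℝ (Fin d) →ₗ[ℝ] ℝ,
      Continuous fun x => D x x := by
    intro D
    have h1 : ∀ x, D x x = ∑ i, x i * D (e i) x := by
      intro x
      have h := congrArg (fun z => D z x) (e.sum_repr x)
      simp only [map_sum, LinearMap.sum_apply, map_smul, LinearMap.smul_apply, smul_eq_mul] at h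
      rw [← h]
      simp [e]
    simp only [h1]
    refine continuous_finsetSum _ fun i _ => ?_
    have := (D (e i)).continuous_of_finiteDimensional
    fun_prop
  refine ⟨A, fun x => 1 / 2 * (B x x - C x x), fun i j hij => ?_, ?_, fun x y => ?_⟩
  · simp [A, not_lt.mpr hij]
  · exact continuous_const.mul ((hcont B).sub (hcont C))
  · rw [← hC]
    have := hBC' x y
    simp only [map_add, LinearMap.add_apply]
    linarith

end BilinearForms

/-! ### Rays and bases in the cone. -/

section Cones

variable {d : ℕ} {P : ProperCone ℝ (EuclideanSpace ℝ (Fin d))}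

/-- The point `t v` of the cone. -/
def coneRay (v : P) (t : ℝ≥0) : P :=
  ⟨(t : ℝ) • (v : EuclideanSpace ℝ (Fin d)), P.toSubmodule.smul_mem (⟨t, t.2⟩ : {r : ℝ // 0 ≤ r}) v.2⟩

theorem coe_coneRay (v : P) (t : ℝ≥0) :
    (coneRay v t : EuclideanSpace ℝ (Fin d)) = (t : ℝ) • (v : EuclideanSpace ℝ (Fin d)) := rfl

theorem coneRay_add (v : P) (s t : ℝ≥0) : coneRay v (s + t) = coneRay v s + coneRay v t :=
  Subtype.ext (by
    change ((s + t : ℝ≥0) : ℝ) • (v : EuclideanSpace ℝ (Fin d)) = _ • _ + _ • _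
    rw [NNReal.coe_add, add_smul])

theorem coneRay_zero (v : P) : coneRay v 0 = 0 :=
  Subtype.ext (by rw [coe_coneRay]; simp)

theorem coneRay_one (v : P) : coneRay v 1 = v :=
  Subtype.ext (by rw [coe_coneRay]; simp)

theorem continuous_coneRay (v : P) : Continuous (coneRay v) :=
  Continuous.subtype_mk (by fun_prop) _

theorem IsSpanningPointed.exists_basis (hP : IsSpanningPointed P) :
    ∃ b : Module.Basis (Fin d) ℝ (EuclideanSpace ℝ (Fin d)), ∀ i, b i ∈ P := by
  have hspan : ⊤ ≤ Submodule.span ℝ (P : Set (EuclideanSpace ℝ (Fin d))) := by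
    intro x _
    have hx : x ∈ (P : Set (EuclideanSpace ℝ (Fin d))) - (P : Set (EuclideanSpace ℝ (Fin d))) := by
      rw [hP.spanning]; trivial
    obtain ⟨y, hy, z, hz, rfl⟩ := hx
    exact Submodule.sub_mem _ (Submodule.subset_span hy) (Submodule.subset_span hz)
  let b := Module.Basis.ofSpan hspan
  let σ := b.indexEquiv (EuclideanSpace.basisFun (Fin d) ℝ).toBasis
  refine ⟨b.reindex σ, fun i => ?_⟩
  rw [Module.Basis.reindex_apply]
  exact Module.Basis.ofSpan_subset hspan ⟨_, rfl⟩

end Cones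

/-! ### From E-semigroups to isometric representations. -/

section Semigroups

variable {H : Type*} [NormedAddCommGroup H] [InnerProductSpace ℂ H] [CompleteSpace H] {d : ℕ}
  {P : ProperCone ℝ (EuclideanSpace ℝ (Fin d))} {α : P → ((H →L[ℂ] H) →⋆ₙₐ[ℂ] (H →L[ℂ] H))}

theorem IsESemigroup.continuous_inner (hα : IsESemigroup α) (T : H →L[ℂ] H) (η ζ : H) :
    Continuous fun x => ⟪η, α x T ζ⟫_ℂ :=
  hα.continuous _ (isNormalFunctional_inner η ζ) T

/-- Repeated halving along a ray would give an infinite descent from a multiplicity above `1`, and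
from multiplicity `0` points near the origin where `α` kills `e ⊗ e`, against continuity and `α 0 =
id`. -/
theorem IsESemigroup.hasMultiplicity_one [Nontrivial H] (hα : IsESemigroup α)
    (hK : ∀ x, LeavesCompactsInvariant (α x)) (x : P) : HasMultiplicity (α x) 1 := by
  obtain ⟨e, he⟩ := exists_norm_eq H zero_le_one
  choose n hn using fun x => (hK x).exists_hasMultiplicity he
  have hmul : ∀ x y, n (x + y) = n x * n y := fun x y =>
    (hn _).unique ((hn x).comp (hn y) (hα.map_add x y)) he
  have hhalf : ∀ x : P, ∀ t : ℝ≥0, n (coneRay x t) = n (coneRay x (t / 2)) * n (coneRay x (t / 2)) := by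
    intro x t
    rw [← hmul, ← coneRay_add, add_halves]
  have hle : ∀ m : ℕ, ∀ t : ℝ≥0, n (coneRay x t) = m → m ≤ 1 := by
    intro m
    induction m using Nat.strong_induction_on with
    | _ m ih =>
      intro t ht
      by_contra hm
      have h := hhalf x t
      rw [ht] at h
      set k := n (coneRay x (t / 2)) with hk
      have hkm : k < m := by nlinarith
      have := ih k hkm (t / 2) rfl
      nlinarith
  have hne : n x ≠ 0 := by
    intro h0
    have hz : ∀ k : ℕ, n (coneRay x ((1 / 2) ^ k)) = 0 := by
      intro k
      induction k with
      | zero => rwa [pow_zero, coneRay_one]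
      | succ k ih =>
        rw [hhalf] at ih
        rw [pow_succ, ← div_eq_mul_one_div]
        simpa using ih
    have hα0 : ∀ k : ℕ, α (coneRay x ((1 / 2) ^ k)) (rankOne ℂ e e) = 0 := by
      intro k
      obtain ⟨ι, _, _, W, hι, -, h⟩ := hn (coneRay x ((1 / 2) ^ k))
      rw [hz k, Fintype.card_eq_zero_iff] at hι
      rw [h, Finset.univ_eq_empty, Finset.sum_empty]
    have hc := (hα.continuous_inner (rankOne ℂ e e) e e).comp (continuous_coneRay x)
    have ht : Tendsto (fun k : ℕ => (1 / 2 : ℝ≥0) ^ k) atTop (𝓝 0) :=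
      NNReal.tendsto_pow_atTop_nhds_zero_of_lt_one (by
        rw [one_div]; exact inv_lt_one_of_one_lt₀ one_lt_two)
    have h1 := (hc.tendsto 0).comp ht
    simp only [Function.comp_def, hα0, coneRay_zero, hα.map_zero] at h1
    have h2 := tendsto_nhds_unique h1 tendsto_const_nhds
    simp [he] at h2
  have h1 := hle (n x) 1 (by rw [coneRay_one])
  have : n x = 1 := by omega
  exact this ▸ hn x

theorem IsESemigroup.exists_implements [Nontrivial H] (hα : IsESemigroup α)
    (hK : ∀ x, LeavesCompactsInvariant (α x)) (x : P) : ∃ V, Implements (α x) V := by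
  obtain ⟨e, he⟩ := exists_norm_eq H zero_le_one
  exact (hα.hasMultiplicity_one hK x).exists_implements (hα.normal x) he

theorem IsESemigroup.exists_multiplier_bilinear [Nontrivial H] (hα : IsESemigroup α)
    (hP : IsSpanningPointed P) (hK : ∀ x, LeavesCompactsInvariant (α x)) :
    ∃ (B : EuclideanSpace ℝ (Fin d) →ₗ[ℝ] EuclideanSpace ℝ (Fin d) →ₗ[ℝ] ℝ)
      (V : P → (H →L[ℂ] H)), (∀ x, Implements (α x) (V x)) ∧
      (∀ x y : P, V x * V y = phase (B x y) • V (x + y)) ∧ ∀ ξ, Continuous fun x => V x ξ := by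
  obtain ⟨b, hb⟩ := hP.exists_basis
  -- Indices `k ≥ d` get the value zero, here and for the coordinates `r`, so ordered products can
  -- be indexed by `ℕ`.
  let v : ℕ → P := fun k => if h : k < d then ⟨b ⟨k, h⟩, hb _⟩ else 0
  have hS : ∀ k, ∃ S : ℝ≥0 → (H →L[ℂ] H), (∀ t, Implements (α (coneRay (v k) t)) (S t)) ∧
      (∀ s t, S (s + t) = S s * S t) ∧ ∀ ξ, Continuous fun t => S t ξ := fun k =>
    exists_continuous_semigroup (fun s t T => by rw [hα.map_add, coneRay_add])
      (fun T => by rw [coneRay_zero, hα.map_zero])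
      (fun T η ζ => (hα.continuous_inner T η ζ).comp (continuous_coneRay _))
      (fun t => hα.exists_implements hK _)
  choose S hSimp hSadd hSc using hS
  have hcomm : ∀ j i, ∃ c : ℝ, ∀ s t, S j s * S i t = phase (c * s * t) • (S i t * S j s) :=
    fun j i => exists_commutation_phase (fun s t T => by rw [hα.map_add, hα.map_add, add_comm])
      (hSimp j) (hSimp i) (hSadd j) (hSadd i) (hSc j) (hSc i)
  choose c hc using hcomm
  let r : ℕ → (EuclideanSpace ℝ (Fin d) →ₗ[ℝ] ℝ) := fun k => if h : k < d then b.coord ⟨k, h⟩ else 0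
  have hrc : ∀ k, Continuous (r k) := fun k => (r k).continuous_of_finiteDimensional
  -- Taking positive parts makes `T` defined and continuous on all of `P`, although it implements
  -- `α` only on `Q`.
  let a : P → ℕ → ℝ≥0 := fun x k => (r k x).toNNReal
  have hac : ∀ k, Continuous fun x => a x k := fun k =>
    continuous_real_toNNReal.comp ((hrc k).comp continuous_subtype_val)
  let B : EuclideanSpace ℝ (Fin d) →ₗ[ℝ] EuclideanSpace ℝ (Fin d) →ₗ[ℝ] ℝ :=
    ∑ j ∈ Finset.range d, ∑ i ∈ Finset.range j, c j i • (r j).smulRight (r i)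
  have hB : ∀ x y, B x y = ∑ j ∈ Finset.range d, ∑ i ∈ Finset.range j, c j i * r j x * r i y := by
    intro x y
    simp [B, LinearMap.sum_apply, mul_assoc]
  let Q : Set P := {x | ∀ k, 0 ≤ r k x}
  have haQ : ∀ x ∈ Q, ∀ k, (a x k : ℝ) = r k x := fun x hx k => Real.coe_toNNReal _ (hx k)
  have hQadd : ∀ x ∈ Q, ∀ y ∈ Q, x + y ∈ Q := fun x hx y hy k => by
    change 0 ≤ r k ((x : EuclideanSpace ℝ (Fin d)) + y)
    rw [_root_.map_add]
    exact add_nonneg (hx k) (hy k)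
  let T : P → (H →L[ℂ] H) := fun x => orderedProd (fun i => S i (a x i)) d
  have himp0 : Implements (α 0) (1 : H →L[ℂ] H) := ⟨fun ξ η => rfl, fun T => by
    rw [hα.map_zero, ← ContinuousLinearMap.star_eq_adjoint, star_one]; rfl⟩
  have hTimp' : ∀ (x : P) (n : ℕ), Implements (α (∑ i ∈ Finset.range n, coneRay (v i) (a x i)))
      (orderedProd (fun i => S i (a x i)) n) := by
    intro x n
    induction n with
    | zero => simpa [orderedProd] using himp0
    | succ n ih =>
      rw [Finset.sum_range_succ]
      exact ih.comp (hSimp n _) (hα.map_add _ _)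
  have hsum : ∀ x ∈ Q, ∑ i ∈ Finset.range d, coneRay (v i) (a x i) = x := by
    intro x hx
    apply Subtype.ext
    rw [AddSubmonoidClass.coe_finsetSum, Finset.sum_range]
    conv_rhs => rw [← b.sum_repr (x : EuclideanSpace ℝ (Fin d))]
    refine Finset.sum_congr rfl fun i _ => ?_
    rw [coe_coneRay, haQ x hx]
    simp [r, v]
  have hTimp : ∀ x ∈ Q, Implements (α x) (T x) := fun x hx => by
    have := hTimp' x d
    rwa [hsum x hx] at this
  have hT : ∀ x ∈ Q, ∀ y ∈ Q, T x * T y = phase (B x y) • T (x + y) := by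
    intro x hx y hy
    have hxy : ∀ i, a (x + y) i = a x i + a y i := by
      intro i
      rw [← NNReal.coe_inj, NNReal.coe_add, haQ _ (hQadd x hx y hy), haQ x hx, haQ y hy, ← _root_.map_add]
      rfl
    simp only [T, hxy]
    rw [orderedProd_mul_orderedProd hSadd hc, hB]
    simp only [haQ x hx, haQ y hy]
  have hTc : ∀ ξ, Continuous fun x => T x ξ := fun ξ =>
    continuous_orderedProd_apply (fun x i => (hSimp i _).norm_map)
      (fun i ξ => (hSc i ξ).comp (hac i)) d ξ
  have hcof : ∀ x₀ : P, ∃ y ∈ Q, ∀ᶠ x in 𝓝 x₀, x + y ∈ Q := by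
    intro x₀
    -- The summand `1` leaves room for a neighbourhood of `x₀`, on which each coordinate drops by
    -- less than `1`.
    let y : P := ∑ i ∈ Finset.range d, coneRay (v i) (‖r i x₀‖₊ + 1)
    have hry : ∀ k < d, r k y = ‖r k x₀‖ + 1 := by
      intro k hk
      simp only [y]
      rw [AddSubmonoidClass.coe_finsetSum, Finset.sum_range, map_sum]
      rw [Fintype.sum_eq_single ⟨k, hk⟩]
      · rw [coe_coneRay]
        simp [r, v, hk]
      · intro i hi
        rw [coe_coneRay]
        have : (i : ℕ) ≠ k := fun h => hi (Fin.ext h)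
        simp [r, v, hk, hi]
    have hr0 : ∀ k, ¬ k < d → ∀ z, r k z = 0 := fun k hk z => by simp [r, hk]
    refine ⟨y, fun k => ?_, ?_⟩
    · by_cases hk : k < d
      · rw [hry k hk]; positivity
      · rw [hr0 k hk]
    · have hev : ∀ᶠ x : P in 𝓝 x₀, ∀ k ∈ Finset.range d, r k x₀ - 1 < r k x := by
        rw [Filter.eventually_all_finset]
        intro k _
        exact ((hrc k).comp continuous_subtype_val).continuousAt.eventually_const_lt
          (by simp)
      filter_upwards [hev] with x hx k
      change 0 ≤ r k ((x : EuclideanSpace ℝ (Fin d)) + y)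
      by_cases hk : k < d
      · rw [_root_.map_add, hry k hk]
        have h1 := hx k (Finset.mem_range.mpr hk)
        have h2 := neg_abs_le (r k x₀)
        rw [Real.norm_eq_abs]
        linarith
      · rw [hr0 k hk]
  have : ContinuousAdd P := ⟨by
    refine Continuous.subtype_mk (p := fun x => x ∈ P)
      (f := fun p : P × P => (p.1 : EuclideanSpace ℝ (Fin d)) + p.2) ?_ _
    fun_prop⟩
  obtain ⟨V, h1, h2, h3⟩ := exists_extension_of_cofinal (B := fun x y : P => B x y) hα.map_add
    hα.continuous_inner (hα.exists_implements hK)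
    (fun x y z => by
      change B ((x : EuclideanSpace ℝ (Fin d)) + y) z = _
      rw [_root_.map_add, LinearMap.add_apply])
    (fun x y z => by
      change B x ((y : EuclideanSpace ℝ (Fin d)) + z) = _
      rw [_root_.map_add])
    (fun y => ((B.flip y).continuous_of_finiteDimensional).comp continuous_subtype_val)
    hQadd hcof hTimp hT hTc
  exact ⟨B, V, h1, h2, h3⟩

end Semigroups

theorem mainTheorem3 {d : ℕ} (P : ProperCone ℝ (EuclideanSpace ℝ (Fin d)))
    (hP : IsSpanningPointed P)
    {H : Type*} [NormedAddCommGroup H] [InnerProductSpace ℂ H] [CompleteSpace H]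
    [TopologicalSpace.SeparableSpace H] (hH : ¬ FiniteDimensional ℂ H)
    (α : P → ((H →L[ℂ] H) →⋆ₙₐ[ℂ] (H →L[ℂ] H))) (hα : IsESemigroup α)
    (hK : ∀ x : P, LeavesCompactsInvariant (α x)) :
    ∃ (V : P → (H →L[ℂ] H)) (A : Matrix (Fin d) (Fin d) ℝ),
      (∀ x : P, Isometry (V x)) ∧
      (∀ ξ : H, Continuous fun x : P => V x ξ) ∧
      IsStrictlyUpperTriangular A ∧
      (∀ (x : P) (T : H →L[ℂ] H), α x T = V x ∘L T ∘L ContinuousLinearMap.adjoint (V x)) ∧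
      (∀ x y : P, V x ∘L V y =
        Complex.exp (Complex.I *
          ((⟪A.toEuclideanLin (x : EuclideanSpace ℝ (Fin d)),
            (y : EuclideanSpace ℝ (Fin d))⟫_ℝ : ℝ) : ℂ)) • V (x + y)) := by
  have : Nontrivial H := by
    by_contra h
    rw [not_nontrivial_iff_subsingleton] at h
    exact hH inferInstance
  obtain ⟨B, V, hV, hmul, hc⟩ := hα.exists_multiplier_bilinear hP hK
  obtain ⟨A, q, hA, hq, hAB⟩ := exists_isStrictlyUpperTriangular B
  -- Twisting by `phase (q x)` changes the multiplier by the coboundary of `q`, turning `B` into the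
  -- form of `A`.
  have hW : ∀ x : P, Implements (α x) (phase (q x) • V x) := fun x => (hV x).smul (norm_phase _)
  refine ⟨fun x => phase (q x) • V x, A, fun x => (hW x).isometry, fun ξ => ?_, hA,
    fun x => (hW x).apply, fun x y => ?_⟩
  · exact ((continuous_phase.comp (hq.comp continuous_subtype_val))).smul (hc ξ)
  · change (phase (q x) • V x) * (phase (q y) • V y) = phase _ • _
    rw [smul_mul_smul_comm, hmul, smul_smul, smul_smul, ← phase_add, ← phase_add, ← phase_add, hAB]
    congr 2
    change _ = _ + q ((x : EuclideanSpace ℝ (Fin d)) + y)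
    ring
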